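/- Let $k$ be a field, let $n>m$ be natural numbers, and let $\mathcal A=\{a_1,\dots,a_n\}\subset\mathbb N^m$ be a set of $n$ distinct nonzero vectors with $a_j=d_je_j$ for $1\le j\le m$, where $d_j\in\mathbb Z^+$ and $e_1,\dots,e_m$ is the canonical basis of $\mathbb Z^m$. Let $I_{\mathcal A}$ be the kernel of the $k$-algebra homomorphism $k[x_1,\dots,x_n]\to k[t_1,\dots,t_m]$, $x_i\mapsto t^{a_i}=t_1^{a_{i1}}\cdots t_m^{a_{im}}$ (a simplicial toric ideal). An ideal $I$ is a *complete intersection* if its minimal number of generators equals its height. For $\mathcal B\subset\mathbb N^m$, $\mathrm{Cone}(\mathcal B)\subset\mathbb R^m$ is the set of nonnegative real combinations of elements of $\mathcal B$. Whenever $a_i\in\mathrm{Cone}(\mathcal A\setminus\{a_i\})$, put $m_i:=\min\{b\in\mathbb Z^+ : b\,a_i\in\sum_{j\ne i}\mathbb N a_j\}$; a *critical binomial with respect to $x_i$* is then a binomial $x_i^{m_i}-\prod_{j\ne i}x_j^{\beta_{ij}}\in I_{\mathcal A}$ with $\beta_{ij}\in\mathbb N$. The set $\mathcal A_{red}$ is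 the output of the following algorithm. Start with $S:=\mathcal A$ and repeat the following pass. Set $G:=S$; for each $a\in G$, taken one after another in any order, replace $S$ by $S\setminus\{a\}$ and then, if $a\in\mathbb Q S$, let $B:=\min\{b\in\mathbb Z^+: b\,a\in\mathbb Z S\}$ and, if $B\,a\notin\mathbb N S$, replace $S$ by $S\cup\{B\,a\}$. Stop after the first pass at whose end $S=\emptyset$ or $S=G$, and output $S$. (Here $\mathbb Q S,\mathbb Z S,\mathbb N S$ are the rational vector space, the group and the monoid generated by $S$.) Suppose that $m_ia_i\ne m_ja_j$ for all $i\neq j$ with $a_i\in\mathrm{Cone}(\mathcal A\setminus\{a_i\})$ and $a_j\in\mathrm{Cone}(\mathcal A\setminus\{a_j\})$. Then the algorithm has exactly one possible output $\mathcal A_{red}$, whatever orders are chosen in its passes, and the following are equivalent: (a) $I_{\mathcal A}$ is a complete intersection; (b) for every choice of $f_{m+1},\dots,f_n$ such that $f_i$ is a critical binomial with respect to $x_i$ for $m+1\le i\le n$, one has $I_{\mathcal A}=(f_{m+1},\dots,f_n)$; (c) $\mathcal A_{red}=\emptyset$. -/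

import Mathlib

namespace SimplicialToric

open MvPolynomial

/-- The toric ideal of `a 0, …, a (n-1) ∈ ℕ^m`: the kernel of the homomorphism of `k`-algebras
`k[x_0, …, x_{n-1}] → k[t_0, …, t_{m-1}]`, `x_i ↦ t ^ (a i)`. -/
noncomputable def toricIdeal (k : Type*) [Field k] {n m : ℕ} (a : Fin n → Fin m → ℕ) :
    Ideal (MvPolynomial (Fin n) k) :=
  RingHom.ker (aeval (fun i => ∏ j, (X j : MvPolynomial (Fin m) k) ^ a i j) :
    MvPolynomial (Fin n) k →ₐ[k] MvPolynomial (Fin m) k)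

/-- An ideal `I` is a complete intersection if its minimal number of generators equals its height.
In a Noetherian ring, such as the polynomial rings used here, every ideal is finitely generated
and `Submodule.spanFinrank I` is the minimal number of generators of `I`. -/
def IsCompleteIntersection {R : Type*} [CommRing R] (I : Ideal R) : Prop :=
  (Submodule.spanFinrank I : ℕ∞) = I.height

/-- The family `a` is of the form `d_0 e_0, …, d_{m-1} e_{m-1}, a m, …, a (n-1)`, with `n > m`,
positive integers `d_j`, and all of its members nonzero and pairwise distinct. -/
structure IsSimplicial {n m : ℕ} (a : Fin n → Fin m → ℕ) : Prop where
  lt : m < n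
  injective : Function.Injective a
  ne_zero : ∀ i, a i ≠ 0
  axis : ∃ d : Fin m → ℕ, (∀ j, 0 < d j) ∧
    ∀ j : Fin m, a (Fin.castLE lt.le j) = Pi.single j (d j)

/-- `a i` lies in the real cone (nonnegative real combinations) spanned by the other vectors. -/
def InConeOfOthers {n m : ℕ} (a : Fin n → Fin m → ℕ) (i : Fin n) : Prop :=
  (fun l => (a i l : ℝ)) ∈
    PointedCone.hull ℝ ((fun v : Fin m → ℕ => fun l => (v l : ℝ)) '' (a '' {j | j ≠ i}))

/-- `m_i`: the least positive integer `b` such that `b • a i ∈ ∑_{j ≠ i} ℕ (a j)`. Such a `b`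
exists when `a i` is in the cone of the other vectors, and `m_i` is only used in that case. -/
noncomputable def critExp {n m : ℕ} (a : Fin n → Fin m → ℕ) (i : Fin n) : ℕ :=
  sInf {b : ℕ | 0 < b ∧ b • a i ∈ AddSubmonoid.closure (a '' {j | j ≠ i})}

/-- `f` is a critical binomial with respect to `x_i`: the vector `a i` is in the cone of the
others, and `f = x_i ^ m_i - ∏_{j ≠ i} x_j ^ (β j)` belongs to the toric ideal. -/
def IsCriticalBinomial (k : Type*) [Field k] {n m : ℕ} (a : Fin n → Fin m → ℕ) (i : Fin n)
    (f : MvPolynomial (Fin n) k) : Prop :=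
  InConeOfOthers a i ∧
    (∃ β : Fin n → ℕ, f = X i ^ critExp a i - ∏ j ∈ Finset.univ.erase i, X j ^ β j) ∧
    f ∈ toricIdeal k a

/-- `a` is in the rational vector space spanned by `T`. -/
def InRatSpan {m : ℕ} (T : Finset (Fin m → ℕ)) (a : Fin m → ℕ) : Prop :=
  (fun l => (a l : ℚ)) ∈
    Submodule.span ℚ ((fun v : Fin m → ℕ => fun l => (v l : ℚ)) '' (T : Set (Fin m → ℕ)))

/-- `B`: the least positive integer `b` such that `b a` is in the subgroup `ℤ T` of `ℤ^m`
generated by `T`. It exists when `a` is in the rational span of `T`, and is only used then. -/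
noncomputable def latticeIndex {m : ℕ} (T : Finset (Fin m → ℕ)) (a : Fin m → ℕ) : ℕ :=
  sInf {b : ℕ | 0 < b ∧ b • (fun l => (a l : ℤ)) ∈
    AddSubgroup.closure ((fun v : Fin m → ℕ => fun l => (v l : ℤ)) '' (T : Set (Fin m → ℕ)))}

open Classical in
/-- The body of the inner loop of the reduction algorithm, for the element `a` of the current
set `S`: remove `a`; if `a` is in the rational span of what remains, and `B a` is not in the
semigroup `ℕ (S \ {a})`, put `B a` in. -/
noncomputable def reduceAt {m : ℕ} (S : Finset (Fin m → ℕ)) (a : Fin m → ℕ) :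
    Finset (Fin m → ℕ) :=
  if InRatSpan (S.erase a) a ∧
      latticeIndex (S.erase a) a • a ∉ AddSubmonoid.closure (S.erase a : Set (Fin m → ℕ)) then
    insert (latticeIndex (S.erase a) a • a) (S.erase a)
  else S.erase a

/-- One execution of the loop "for all `a ∈ G`", started with the current set equal to `G`: it
treats the elements of `G` once each, in some order, and ends with the current set `G'`. -/
def ReductionPass {m : ℕ} (G G' : Finset (Fin m → ℕ)) : Prop :=
  ∃ l : List (Fin m → ℕ), l.Nodup ∧ l.toFinset = G ∧ G' = l.foldl reduceAt G

/-- `IsReduction A R`: the reduction algorithm with input `A` can return the output `R` (for some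
orders in which its inner loops treat the elements). It repeats passes until the current set
is empty or is left unchanged by a pass. -/
inductive IsReduction {m : ℕ} : Finset (Fin m → ℕ) → Finset (Fin m → ℕ) → Prop
  | last {G R : Finset (Fin m → ℕ)} (pass : ReductionPass G R) (h : R = ∅ ∨ R = G) :
      IsReduction G R
  | again {G G' R : Finset (Fin m → ℕ)} (pass : ReductionPass G G') (h : ¬(G' = ∅ ∨ G' = G))
      (rest : IsReduction G' R) : IsReduction G R

end SimplicialToric

/-!
Write `m_i` for the critical exponent of `a i` and `deg u = ∑ j, u j • a j`. A set that occurs in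
the reduction algorithm is recorded by a *state* `c : Fin n → ℕ`: the current form of `a i` is
`c i • a i`, and `c i = 0` if it has been removed. Since `0` is the greatest element for
divisibility, every step of the algorithm increases the state in the divisibility order.

**The invariant.** Treating `i` replaces `c i` by its least positive multiple `b` such that `b • a i`
is in the group generated by the other vectors (`b = 0` if there is none), and removes `a i` if `m_i ∣ b`. Each remaining `a i` keeps
a critical relation `m_i a_i = deg β` in the vectors of the state (`GoodState.step`). Indeed, in
such a relation for `a j`, the exponent of the treated `a i` is a multiple of `b`; if `a i` is
removed, then `b = m_i` and one can substitute a critical relation of `a i`. The result contains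
`a j` only if `m_i a_i = m_j a_j`, which is excluded (`mul_eq_zero_of_critical`).

**Uniqueness and termination.** A state `r` is *stable* if `r i • a i` is in the group of the others
and `m_i ∤ r i` whenever `r i ≠ 0`. Outputs are stable, and a stable state that is a multiple of `c`
remains a multiple of everything reached from `c` (`Stable.step_dvd`), so the output is the least
multiple of the initial state among the stable states. While nothing is removed, an integral
relation with nonzero coefficients at all remaining indices bounds the multipliers
(`exists_isReduction`).

**Empty output implies generation.** Going back along a run that removes everything, the critical
relations generate all relations in each state (`Reach.congruence_of_zero`). The axis vectors have
no critical relations in this case: two vectors on one axis would have to be reduced to a single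
one, and the last removal on the axis would make two degrees `m_i a_i` equal
(`step_self_ne_zero_of_axis`).

**Complete intersections.** The toric ideal `I` has height `n - m` (`height_toricIdeal`). The
monomial `x_i ^ m_i` shares its degree with no other monomial divisible by `x_i`, so the coefficient
at it is a functional on `I / 𝔪 I`, where `𝔪 = (x_0, …, x_{n-1})`; by the hypothesis on the degrees
these functionals are dual to the critical binomials `f_i`, `i ≥ m`. If `I` has `n - m` generators,
the `f_i` therefore generate `I` modulo `𝔪 I`, hence generate `I` by Nakayama's lemma.

**Generation implies empty output.** Suppose that the binomials `f_j = x_j ^ m_j - x ^ β_j`,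
`j ≥ m`, generate `I`. The relation `β_j i ≠ 0` on the indices has no cycle: on a cycle `C` all
`f_j` would be in the ideal of the `x_i`, `i ∈ C`, so that `I` would be properly contained in a minimal prime
over `n - m` elements, against Krull's height theorem (`IsSimplicial.exists_critical_avoiding`).
So the lattice of relations has a basis that is triangular with diagonal entries `m_i`, and the
first `i` with `r i ≠ 0` in a stable state `r` would satisfy `m_i ∣ r i`.
-/

namespace SimplicialToric

/-! ### Degrees and critical exponents -/

section Closure

variable {ι : Type*} [Fintype ι]

theorem mem_addSubmonoidClosure_image_iff {M : Type*} [AddCommMonoid M] (v : ι → M) (P : Set ι)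
    (x : M) : x ∈ AddSubmonoid.closure (v '' P) ↔
      ∃ u : ι → ℕ, (∀ j, j ∉ P → u j = 0) ∧ ∑ j, u j • v j = x := by
  classical
  constructor
  · intro h
    induction h using AddSubmonoid.closure_induction with
    | mem x hx =>
      obtain ⟨i, hi, rfl⟩ := hx
      refine ⟨Pi.single i 1, fun j hj => ?_, ?_⟩
      · rw [Pi.single_eq_of_ne]
        rintro rfl
        exact hj hi
      · rw [Finset.sum_eq_single i] <;> simp +contextual
    | zero => exact ⟨0, by simp, by simp⟩
    | add x y _ _ hx hy =>
      obtain ⟨u, hu, rfl⟩ := hx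
      obtain ⟨w, hw, rfl⟩ := hy
      refine ⟨u + w, fun j hj => by simp [hu j hj, hw j hj], ?_⟩
      simp [add_smul, Finset.sum_add_distrib]
  · rintro ⟨u, hu, rfl⟩
    refine sum_mem fun j _ => ?_
    by_cases hj : j ∈ P
    · exact nsmul_mem (AddSubmonoid.subset_closure (Set.mem_image_of_mem v hj)) _
    · simp [hu j hj]

theorem mem_addSubgroupClosure_image_iff {M : Type*} [AddCommGroup M] (v : ι → M) (P : Set ι)
    (x : M) : x ∈ AddSubgroup.closure (v '' P) ↔
      ∃ u : ι → ℤ, (∀ j, j ∉ P → u j = 0) ∧ ∑ j, u j • v j = x := by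
  classical
  constructor
  · intro h
    induction h using AddSubgroup.closure_induction with
    | mem x hx =>
      obtain ⟨i, hi, rfl⟩ := hx
      refine ⟨Pi.single i 1, fun j hj => ?_, ?_⟩
      · rw [Pi.single_eq_of_ne]
        rintro rfl
        exact hj hi
      · rw [Finset.sum_eq_single i] <;> simp +contextual
    | zero => exact ⟨0, by simp, by simp⟩
    | add x y _ _ hx hy =>
      obtain ⟨u, hu, rfl⟩ := hx
      obtain ⟨w, hw, rfl⟩ := hy
      refine ⟨u + w, fun j hj => by simp [hu j hj, hw j hj], ?_⟩
      simp [add_smul, Finset.sum_add_distrib]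
    | neg x _ hx =>
      obtain ⟨u, hu, rfl⟩ := hx
      exact ⟨-u, fun j hj => by simp [hu j hj], by simp⟩
  · rintro ⟨u, hu, rfl⟩
    refine sum_mem fun j _ => ?_
    by_cases hj : j ∈ P
    · exact zsmul_mem (AddSubgroup.subset_closure (Set.mem_image_of_mem v hj)) _
    · simp [hu j hj]

end Closure

variable {n m : ℕ}

/-- The degree `∑ j, u j • a j` of the exponent vector `u`. -/
def wt (a : Fin n → Fin m → ℕ) : (Fin n → ℕ) →+ (Fin m → ℕ) where
  toFun u := ∑ j, u j • a j
  map_zero' := by simp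
  map_add' u v := by simp [add_smul, Finset.sum_add_distrib]

/-- The degree of an integer exponent vector; its kernel is the lattice of relations. -/
def zwt (a : Fin n → Fin m → ℕ) : (Fin n → ℤ) →+ (Fin m → ℤ) where
  toFun u := ∑ j, u j • (fun l => (a j l : ℤ))
  map_zero' := by simp
  map_add' u v := by simp [add_smul, Finset.sum_add_distrib]

theorem wt_def (a : Fin n → Fin m → ℕ) (u : Fin n → ℕ) : wt a u = ∑ j, u j • a j := rfl

theorem zwt_def (a : Fin n → Fin m → ℕ) (u : Fin n → ℤ) :
    zwt a u = ∑ j, u j • (fun l => (a j l : ℤ)) := rfl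

theorem wt_apply (a : Fin n → Fin m → ℕ) (u : Fin n → ℕ) (l : Fin m) :
    wt a u l = ∑ j, u j * a j l := by
  simp [wt_def]

@[simp]
theorem wt_single (a : Fin n → Fin m → ℕ) (i : Fin n) (b : ℕ) :
    wt a (Pi.single i b) = b • a i := by
  rw [wt_def, Finset.sum_eq_single i] <;> simp +contextual

@[simp]
theorem zwt_single (a : Fin n → Fin m → ℕ) (i : Fin n) (b : ℤ) :
    zwt a (Pi.single i b) = b • (fun l => (a i l : ℤ)) := by
  rw [zwt_def, Finset.sum_eq_single i] <;> simp +contextual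

theorem zwt_natCast (a : Fin n → Fin m → ℕ) (u : Fin n → ℕ) :
    zwt a (fun j => (u j : ℤ)) = fun l => (wt a u l : ℤ) := by
  ext l
  simp [zwt_def, wt_apply]

theorem wt_eq_wt_iff (a : Fin n → Fin m → ℕ) (u v : Fin n → ℕ) :
    wt a u = wt a v ↔ zwt a (fun j => (u j : ℤ)) = zwt a (fun j => (v j : ℤ)) := by
  simp only [zwt_natCast, funext_iff, Nat.cast_inj]

theorem wt_eq_zero {a : Fin n → Fin m → ℕ} (hz : ∀ i, a i ≠ 0) {u : Fin n → ℕ}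
    (h : wt a u = 0) : u = 0 := by
  ext j
  obtain ⟨l, hl⟩ := Function.ne_iff.1 (hz j)
  have := congrFun h l
  rw [wt_apply, Pi.zero_apply, Finset.sum_eq_zero_iff] at this
  simpa [show a j l ≠ 0 from hl] using this j (Finset.mem_univ j)

theorem mem_closure_others_iff (a : Fin n → Fin m → ℕ) (i : Fin n) (x : Fin m → ℕ) :
    x ∈ AddSubmonoid.closure (a '' {j | j ≠ i}) ↔ ∃ β : Fin n → ℕ, β i = 0 ∧ wt a β = x := by
  rw [mem_addSubmonoidClosure_image_iff]
  simp [wt_def]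

theorem critExp_le {a : Fin n → Fin m → ℕ} {i : Fin n} {b : ℕ} (hb : b ≠ 0) {β : Fin n → ℕ}
    (hi : β i = 0) (h : wt a β = b • a i) : critExp a i ≠ 0 ∧ critExp a i ≤ b := by
  have hmem : b ∈ {b : ℕ | 0 < b ∧ b • a i ∈ AddSubmonoid.closure (a '' {j | j ≠ i})} :=
    ⟨Nat.pos_of_ne_zero hb, (mem_closure_others_iff a i _).2 ⟨β, hi, h⟩⟩
  exact ⟨(Nat.sInf_mem ⟨b, hmem⟩).1.ne', Nat.sInf_le hmem⟩

theorem exists_wt_eq_critExp {a : Fin n → Fin m → ℕ} {i : Fin n} (h : critExp a i ≠ 0) :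
    ∃ β : Fin n → ℕ, β i = 0 ∧ wt a β = critExp a i • a i := by
  have hne : {b : ℕ | 0 < b ∧ b • a i ∈ AddSubmonoid.closure (a '' {j | j ≠ i})}.Nonempty :=
    Nat.nonempty_of_sInf_eq_succ (Nat.succ_pred_eq_of_ne_zero h).symm
  exact (mem_closure_others_iff a i _).1 (Nat.sInf_mem hne).2

/-- An exponent vector `w` of degree `b • a j`, other than `b` times the `j`-th basis vector, has
`w j ≤ b - m_j`: removing its `j`-th entry leaves a relation for `(b - w j) • a j`. -/
theorem critExp_le_of_wt_eq {a : Fin n → Fin m → ℕ} (hz : ∀ i, a i ≠ 0) {j : Fin n} {b : ℕ}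
    {w : Fin n → ℕ} (h : wt a w = b • a j) (hb : w ≠ Pi.single j b) :
    w j < b ∧ critExp a j ≠ 0 ∧ critExp a j ≤ b - w j := by
  have hw : w = Pi.single j (w j) + Function.update w j 0 := by
    ext l
    by_cases hl : l = j
    · subst hl; simp
    · simp [hl]
  have h1 : w j • a j + wt a (Function.update w j 0) = b • a j := by
    rw [← h]
    conv_rhs => rw [hw]
    simp
  have hlt : w j < b := by
    by_contra hge
    push Not at hge
    have h2 : (w j - b) • a j + wt a (Function.update w j 0) = 0 := by
      have : b • a j + ((w j - b) • a j + wt a (Function.update w j 0)) = b • a j + 0 := by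
        rw [← add_assoc, ← add_smul, Nat.add_sub_cancel' hge, h1, add_zero]
      exact add_left_cancel this
    have h3 : wt a (Pi.single j (w j - b) + Function.update w j 0) = 0 := by simpa using h2
    have h4 := wt_eq_zero hz h3
    have h5 : w j - b = 0 := by simpa using congrFun h4 j
    refine hb ?_
    have h6 : Function.update w j 0 = 0 := by simpa [h5] using h4
    rw [hw, h6, add_zero, show w j = b by omega]
  refine ⟨hlt, critExp_le (β := Function.update w j 0) (by omega) (by simp) ?_⟩
  have : w j • a j + wt a (Function.update w j 0) = w j • a j + (b - w j) • a j := by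
    rw [h1, ← add_smul, Nat.add_sub_cancel' hlt.le]
  exact add_left_cancel this

/-- The degrees `m_i a_i` of the critical binomials are pairwise different. -/
def CritDistinct (a : Fin n → Fin m → ℕ) : Prop :=
  ∀ i j : Fin n, i ≠ j → critExp a i ≠ 0 → critExp a j ≠ 0 →
    critExp a i • a i ≠ critExp a j • a j

/-- Two critical relations `m_i a_i = ∑ βi`, `m_j a_j = ∑ β` with `β i = m_i q`: substituting the
first one, `q` times, into the second does not bring `a_j` back. -/
theorem mul_eq_zero_of_critical {a : Fin n → Fin m → ℕ} (hz : ∀ i, a i ≠ 0) (H : CritDistinct a)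
    {i j : Fin n} (hij : i ≠ j) {βi β : Fin n → ℕ} {q : ℕ} (hmi : critExp a i ≠ 0)
    (hmj : critExp a j ≠ 0) (hi0 : βi i = 0) (hi : wt a βi = critExp a i • a i) (hj0 : β j = 0)
    (hj : wt a β = critExp a j • a j) (hq : β i = critExp a i * q) : q * βi j = 0 := by
  by_contra hne
  obtain ⟨hq0, hβ0⟩ := mul_ne_zero_iff.1 hne
  have hβ : β = Pi.single i (critExp a i * q) + Function.update β i 0 := by
    ext l
    by_cases hl : l = i
    · subst hl; simp [hq]
    · simp [hl]
  set w := q • βi + Function.update β i 0 with hw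
  have hwt : wt a w = critExp a j • a j := by
    rw [← hj, congrArg (wt a) hβ, hw, map_add, map_nsmul, hi, map_add, wt_single, smul_smul,
      mul_comm q]
  have hwj : w j = q * βi j := by simp [hw, Function.update_of_ne hij.symm, hj0]
  have hws : w = Pi.single j (critExp a j) := by
    by_contra h
    obtain ⟨h1, -, h2⟩ := critExp_le_of_wt_eq hz hwt h
    rw [hwj] at h1 h2
    omega
  -- the whole relation of `a i` is a multiple of `a j`
  have hβs : βi = Pi.single j (βi j) := by
    ext l
    by_cases hl : l = j
    · subst hl; simp
    · have := congrFun hws l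
      simp only [hw, Pi.add_apply, Pi.smul_apply, smul_eq_mul, Pi.single_eq_of_ne hl] at this
      rw [Pi.single_eq_of_ne hl]
      have h0 : q * βi l = 0 := by omega
      exact (mul_eq_zero.1 h0).resolve_left hq0
  have hdeg : βi j • a j = critExp a i • a i := by
    rw [← hi, congrArg (wt a) hβs, wt_single]
  have hle : critExp a j ≤ βi j :=
    (critExp_le (β := Pi.single i (critExp a i)) hβ0 (by simp [hij.symm])
      (by simp [hdeg])).2
  have heq : critExp a j = q * βi j := by
    rw [← hwj, hws]; simp
  have hq1 : q = 1 := by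
    have : 0 < βi j := Nat.pos_of_ne_zero hβ0
    rw [heq] at hle
    have : q ≤ 1 := by nlinarith
    omega
  refine H i j hij hmi hmj ?_
  rw [← hdeg, heq, hq1, one_mul]

/-! ### Labelled states of the reduction algorithm -/

/-- The set of vectors encoded by a state `c`: the current form of the vector `a i` is
`c i • a i`, and `c i = 0` means that it has been removed. The divisibility order, in which `0` is
the greatest element, is the order in which a state can evolve. -/
def config (a : Fin n → Fin m → ℕ) (c : Fin n → ℕ) : Finset (Fin m → ℕ) :=
  (Finset.univ.filter (fun i => c i ≠ 0)).image (fun i => c i • a i)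

/-- The vectors of the state `c` are pairwise different. -/
def InjState (a : Fin n → Fin m → ℕ) (c : Fin n → ℕ) : Prop :=
  ∀ i j, c i ≠ 0 → c j ≠ 0 → c i • a i = c j • a j → i = j

/-- `z • a i` belongs to the group generated by the vectors `c j • a j` with `j ≠ i`. -/
def Dep (a : Fin n → Fin m → ℕ) (c : Fin n → ℕ) (i : Fin n) (z : ℤ) : Prop :=
  ∃ γ : Fin n → ℤ, γ i = 0 ∧ (∀ j, (c j : ℤ) ∣ γ j) ∧ zwt a γ = z • (fun l => (a i l : ℤ))

/-- The multiplier by which `a i` is represented once the algorithm has multiplied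
`c i • a i` by its lattice index; it is `0` if no multiple is in the lattice of the others. -/
noncomputable def stepVal (a : Fin n → Fin m → ℕ) (c : Fin n → ℕ) (i : Fin n) : ℕ :=
  latticeIndex ((config a c).erase (c i • a i)) (c i • a i) * c i

open Classical in
/-- The effect on states of the inner loop for the label `i`: it is removed exactly when the new
multiplier is a multiple of the critical exponent, which covers the case of a vector outside the
rational span of the others, where the new multiplier is `0`. -/
noncomputable def step (a : Fin n → Fin m → ℕ) (c : Fin n → ℕ) (i : Fin n) : Fin n → ℕ :=
  Function.update c i (if critExp a i ∣ stepVal a c i then 0 else stepVal a c i)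

theorem sInf_dvd_iff {M : Type*} [AddCommGroup M] (K : AddSubgroup M) (x : M) (b : ℕ) :
    sInf {b : ℕ | 0 < b ∧ b • x ∈ K} ∣ b ↔ b • x ∈ K := by
  set B := sInf {b : ℕ | 0 < b ∧ b • x ∈ K} with hB
  rcases Set.eq_empty_or_nonempty {b : ℕ | 0 < b ∧ b • x ∈ K} with h | h
  · have hB0 : B = 0 := by rw [hB, h, Nat.sInf_empty]
    rw [hB0, zero_dvd_iff]
    constructor
    · rintro rfl
      simp
    · intro hb
      by_contra h0
      exact Set.notMem_empty b (h ▸ ⟨Nat.pos_of_ne_zero h0, hb⟩)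
  · have hmem : 0 < B ∧ B • x ∈ K := Nat.sInf_mem h
    constructor
    · rintro ⟨d, rfl⟩
      rw [mul_comm, mul_smul]
      exact nsmul_mem hmem.2 d
    · intro hb
      have hr : (b % B) • x ∈ K := by
        have h1 : (b / B) • B • x ∈ K := nsmul_mem hmem.2 _
        have h2 : b • x = (b % B) • x + (b / B) • B • x := by
          rw [← mul_smul, ← add_smul, mul_comm (b / B), Nat.mod_add_div]
        rw [h2] at hb
        exact (AddSubgroup.add_mem_cancel_right K h1).1 hb
      rw [Nat.dvd_iff_mod_eq_zero]
      by_contra h0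
      have : B ≤ b % B := Nat.sInf_le ⟨Nat.pos_of_ne_zero h0, hr⟩
      exact absurd (Nat.mod_lt b hmem.1) (by omega)

theorem coe_erase_config {a : Fin n → Fin m → ℕ} {c : Fin n → ℕ} (hc : InjState a c) {i : Fin n}
    (hi : c i ≠ 0) : (((config a c).erase (c i • a i) : Finset (Fin m → ℕ)) : Set (Fin m → ℕ)) =
      (fun j => c j • a j) '' {j | c j ≠ 0 ∧ j ≠ i} := by
  ext x
  simp only [config, Finset.coe_erase, Finset.coe_image, Finset.coe_filter, Finset.mem_univ,
    true_and, Set.mem_sdiff, Set.mem_image, Set.mem_ofPred_eq, Set.mem_singleton_iff]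
  constructor
  · rintro ⟨⟨j, hj, rfl⟩, hne⟩
    refine ⟨j, ⟨hj, ?_⟩, rfl⟩
    rintro rfl
    exact hne rfl
  · rintro ⟨j, ⟨hj, hji⟩, rfl⟩
    exact ⟨⟨j, hj, rfl⟩, fun h => hji (hc j i hj hi h)⟩

theorem mem_closure_erase_config_iff {a : Fin n → Fin m → ℕ} {c : Fin n → ℕ} (hc : InjState a c)
    {i : Fin n} (hi : c i ≠ 0) (x : Fin m → ℕ) :
    x ∈ AddSubmonoid.closure (((config a c).erase (c i • a i) : Finset (Fin m → ℕ)) :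
        Set (Fin m → ℕ)) ↔
      ∃ β : Fin n → ℕ, β i = 0 ∧ (∀ j, c j ∣ β j) ∧ wt a β = x := by
  rw [coe_erase_config hc hi, mem_addSubmonoidClosure_image_iff]
  constructor
  · rintro ⟨u, hu, rfl⟩
    refine ⟨fun j => u j * c j, ?_, fun j => Dvd.intro_left _ rfl, ?_⟩
    · simp [hu i (by simp)]
    · simp [wt_def, mul_smul]
  · rintro ⟨β, hβi, hβ, rfl⟩
    refine ⟨fun j => β j / c j, fun j hj => ?_, ?_⟩
    · by_cases hj0 : c j = 0
      · simp [hj0]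
      · have : j = i := by
          by_contra hji
          exact hj ⟨hj0, hji⟩
        simp [this, hβi]
    · refine Finset.sum_congr rfl fun j _ => ?_
      rw [smul_smul, Nat.div_mul_cancel (hβ j)]

theorem smul_mem_closure_erase_config_iff {a : Fin n → Fin m → ℕ} {c : Fin n → ℕ}
    (hc : InjState a c) {i : Fin n} (hi : c i ≠ 0) (b : ℕ) :
    b • (fun l => ((c i • a i) l : ℤ)) ∈ AddSubgroup.closure
        ((fun v : Fin m → ℕ => fun l => (v l : ℤ)) ''
          (((config a c).erase (c i • a i) : Finset (Fin m → ℕ)) : Set (Fin m → ℕ))) ↔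
      Dep a c i ((b * c i : ℕ) : ℤ) := by
  rw [coe_erase_config hc hi, Set.image_image, mem_addSubgroupClosure_image_iff]
  have key : b • (fun l => ((c i • a i) l : ℤ)) =
      ((b * c i : ℕ) : ℤ) • (fun l => (a i l : ℤ)) := by
    ext l
    simp [mul_assoc]
  rw [key]
  constructor
  · rintro ⟨u, hu, h⟩
    refine ⟨fun j => u j * c j, ?_, fun j => Dvd.intro_left _ rfl, ?_⟩
    · simp [hu i (by simp)]
    · rw [← h]
      ext l
      simp [zwt_def, mul_assoc]
  · rintro ⟨γ, hγi, hγ, h⟩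
    refine ⟨fun j => γ j / c j, fun j hj => ?_, ?_⟩
    · by_cases hj0 : c j = 0
      · simp [hj0]
      · have : j = i := by
          by_contra hji
          exact hj ⟨hj0, hji⟩
        simp [this, hγi]
    · rw [← h]
      ext l
      simp [zwt_def, ← mul_assoc, Int.ediv_mul_cancel (hγ _)]

theorem stepVal_dvd_iff {a : Fin n → Fin m → ℕ} {c : Fin n → ℕ}
    (hc : InjState a c) {i : Fin n} (hi : c i ≠ 0) (z : ℕ) :
    stepVal a c i ∣ z ↔ c i ∣ z ∧ Dep a c i z := by
  have h := fun b => (sInf_dvd_iff _ _ b).trans (smul_mem_closure_erase_config_iff hc hi b)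
  constructor
  · rintro ⟨d, rfl⟩
    have hd : c i ∣ stepVal a c i * d := Dvd.dvd.mul_right (Dvd.intro_left _ rfl) _
    refine ⟨hd, ?_⟩
    have := (h (latticeIndex ((config a c).erase (c i • a i)) (c i • a i) * d)).1 ⟨d, rfl⟩
    rwa [mul_right_comm] at this
  · rintro ⟨⟨d, rfl⟩, hz⟩
    rw [mul_comm] at hz
    rw [mul_comm (c i)]
    exact Nat.mul_dvd_mul_right ((h d).2 hz) _

theorem dvd_step {a : Fin n → Fin m → ℕ} {c : Fin n → ℕ} (i j : Fin n) :
    c j ∣ step a c i j := by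
  unfold step
  by_cases hj : j = i
  · subst hj
    rw [Function.update_self]
    split_ifs
    · exact dvd_zero _
    · exact Dvd.intro_left _ rfl
  · simp [hj]

theorem step_of_ne {a : Fin n → Fin m → ℕ} {c : Fin n → ℕ} {i j : Fin n} (h : j ≠ i) :
    step a c i j = c j := by
  simp [step, h]

/-- The invariant of the states: the vectors are distinct and, for each remaining `i`, the
critical relation of `a i` can still be expressed by the remaining multiples of the others. -/
structure GoodState (a : Fin n → Fin m → ℕ) (c : Fin n → ℕ) : Prop where
  inj : InjState a c
  dvd : ∀ i, c i ≠ 0 → c i ∣ critExp a i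
  crit : ∀ i, c i ≠ 0 → critExp a i ≠ 0 →
    ∃ β : Fin n → ℕ, β i = 0 ∧ (∀ j, c j ∣ β j) ∧ wt a β = critExp a i • a i

theorem goodState_one {a : Fin n → Fin m → ℕ} (ha : Function.Injective a) :
    GoodState a (fun _ => 1) where
  inj i j _ _ h := ha (by simpa using h)
  dvd i _ := one_dvd _
  crit i _ h := by
    obtain ⟨β, h1, h2⟩ := exists_wt_eq_critExp h
    exact ⟨β, h1, fun _ => one_dvd _, h2⟩

theorem GoodState.stepVal_dvd {a : Fin n → Fin m → ℕ} {c : Fin n → ℕ} (hc : GoodState a c)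
    {i : Fin n} (hi : c i ≠ 0) : stepVal a c i ∣ critExp a i := by
  by_cases h : critExp a i = 0
  · rw [h]
    exact dvd_zero _
  · obtain ⟨β, h1, h2, h3⟩ := hc.crit i hi h
    refine (stepVal_dvd_iff hc.inj hi _).2 ⟨hc.dvd i hi, fun j => (β j : ℤ), by simp [h1],
      fun j => Int.natCast_dvd_natCast.2 (h2 j), ?_⟩
    rw [zwt_natCast, h3]
    ext l
    simp

/-- If the degree of `β` is a combination of the `c j • a j`, `j ≠ i`, then the exponent `β i` is
a multiple of the new multiplier of `i`. -/
theorem stepVal_dvd_of_wt_eq {a : Fin n → Fin m → ℕ} {c : Fin n → ℕ} (hc : InjState a c)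
    {i : Fin n} (hi : c i ≠ 0) {u v : Fin n → ℕ} (hu : ∀ j, c j ∣ u j) (hv : ∀ j, c j ∣ v j)
    (h : wt a u = wt a v) (hle : v i ≤ u i) : stepVal a c i ∣ u i - v i := by
  refine (stepVal_dvd_iff hc hi _).2 ⟨Nat.dvd_sub (hu i) (hv i),
    Function.update (fun j => (v j : ℤ) - u j) i 0, by simp, fun j => ?_, ?_⟩
  · by_cases hj : j = i
    · simp [hj]
    · rw [Function.update_of_ne hj]
      exact dvd_sub (Int.natCast_dvd_natCast.2 (hv j)) (Int.natCast_dvd_natCast.2 (hu j))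
  · have h1 : (fun j => (v j : ℤ) - u j) = Function.update (fun j => (v j : ℤ) - u j) i 0 +
        Pi.single i ((v i : ℤ) - u i) := by
      ext l
      by_cases hl : l = i
      · subst hl; simp
      · simp [hl]
    have h2 : zwt a (fun j => (v j : ℤ) - u j) = 0 := by
      have : (fun j => (v j : ℤ) - u j) = (fun j => (v j : ℤ)) - (fun j => (u j : ℤ)) := rfl
      rw [this, map_sub, (wt_eq_wt_iff a u v).1 h, sub_self]
    rw [h1, map_add, zwt_single] at h2
    rw [eq_neg_of_add_eq_zero_left h2, ← neg_smul, Nat.cast_sub hle]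
    simp

theorem GoodState.critExp_eq_stepVal {a : Fin n → Fin m → ℕ} {c : Fin n → ℕ} (hc : GoodState a c)
    {i : Fin n} (hi : c i ≠ 0) (h : critExp a i ∣ stepVal a c i) :
    critExp a i = stepVal a c i :=
  Nat.dvd_antisymm h (hc.stepVal_dvd hi)

/-- Replacing the occurrences of `a i` in an exponent vector `u` by a relation for a multiple of
`a i` does not change the degree. -/
theorem wt_update_add_smul {a : Fin n → Fin m → ℕ} {i : Fin n} {βi u : Fin n → ℕ} {k q : ℕ}
    (hβ : wt a βi = k • a i) (hq : u i = k * q) :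
    wt a (Function.update u i 0 + q • βi) = wt a u := by
  have h : u = Function.update u i 0 + Pi.single i (k * q) := by
    ext l
    by_cases hl : l = i
    · subst hl; simp [hq]
    · simp [hl]
  conv_rhs => rw [h]
  rw [map_add, map_add, map_nsmul, hβ, wt_single, smul_smul, mul_comm q]

/-- Replacing the occurrences of `a i` in an exponent vector by a relation does not change its
class, for a congruence that contains the relation. -/
theorem rel_update_add_smul {r : AddCon (Fin n → ℕ)} {i : Fin n} {βi u : Fin n → ℕ} {k q : ℕ}
    (hβ : r (Pi.single i k) βi) (hq : u i = k * q) :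
    r u (Function.update u i 0 + q • βi) := by
  have h : u = Function.update u i 0 + q • Pi.single i k := by
    ext l
    by_cases hl : l = i
    · subst hl; simp [hq, mul_comm]
    · simp [hl]
  have h1 : r (Function.update u i 0 + q • Pi.single i k) (Function.update u i 0 + q • βi) :=
    r.add (r.refl _) (r.nsmul q hβ)
  rwa [← h] at h1

/-- Critical relations survive a step: those of the remaining vectors can be rewritten, modulo the
relation of the removed vector, so as to use only the vectors of the new state. -/
theorem GoodState.exists_crit_step {a : Fin n → Fin m → ℕ} (hz : ∀ i, a i ≠ 0)
    (H : CritDistinct a) {c : Fin n → ℕ} (hc : GoodState a c) {i : Fin n} (hi : c i ≠ 0)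
    {r : AddCon (Fin n → ℕ)} (hr : ∀ j, c j ≠ 0 → critExp a j ≠ 0 → ∃ β : Fin n → ℕ, β j = 0 ∧
      (∀ l, c l ∣ β l) ∧ wt a β = critExp a j • a j ∧ r (Pi.single j (critExp a j)) β)
    (j : Fin n) (hj : step a c i j ≠ 0) (hmj : critExp a j ≠ 0) :
    ∃ β : Fin n → ℕ, β j = 0 ∧ (∀ l, step a c i l ∣ β l) ∧ wt a β = critExp a j • a j ∧
      r (Pi.single j (critExp a j)) β := by
  by_cases hji : j = i
  · subst hji
    obtain ⟨β, h1, h2, h3⟩ := hr j hi hmj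
    refine ⟨β, h1, fun l => ?_, h3⟩
    by_cases hl : l = j
    · simp [hl, h1]
    · rw [step_of_ne hl]
      exact h2 l
  · rw [step_of_ne hji] at hj
    obtain ⟨β, h1, h2, h3, h3'⟩ := hr j hj hmj
    have hb : stepVal a c i ∣ β i := by
      have := stepVal_dvd_of_wt_eq hc.inj hi (v := Pi.single j (critExp a j)) h2
        (fun l => ?_) (by simpa using h3) (by simp [Ne.symm hji])
      · simpa [Ne.symm hji] using this
      · by_cases hl : l = j
        · subst hl; simpa using hc.dvd l hj
        · simp [hl]
    by_cases hdv : critExp a i ∣ stepVal a c i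
    · have hm := hc.critExp_eq_stepVal hi hdv
      by_cases hm0 : critExp a i = 0
      · refine ⟨β, h1, fun l => ?_, h3, h3'⟩
        by_cases hl : l = i
        · subst hl
          rw [← hm, hm0, zero_dvd_iff] at hb
          rw [hb]
          exact dvd_zero _
        · rw [step_of_ne hl]
          exact h2 l
      · obtain ⟨βi, g1, g2, g3, g4⟩ := hr i hi hm0
        rw [← hm] at hb
        obtain ⟨q, hq⟩ := hb
        have hzero := mul_eq_zero_of_critical hz H (Ne.symm hji) hm0 hmj g1 g3 h1 h3 hq
        refine ⟨Function.update β i 0 + q • βi, ?_, fun l => ?_, ?_,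
          r.trans h3' (rel_update_add_smul g4 hq)⟩
        · simp [hji, h1, hzero]
        · by_cases hl : l = i
          · subst hl; simp [g1]
          · rw [step_of_ne hl]
            simpa [hl] using dvd_add (h2 l) (Dvd.dvd.mul_left (g2 l) q)
        · rw [wt_update_add_smul g3 hq, h3]
    · refine ⟨β, h1, fun l => ?_, h3, h3'⟩
      by_cases hl : l = i
      · subst hl
        simpa [step, hdv] using hb
      · rw [step_of_ne hl]
        exact h2 l

theorem GoodState.step {a : Fin n → Fin m → ℕ} (hz : ∀ i, a i ≠ 0) (H : CritDistinct a)
    {c : Fin n → ℕ} (hc : GoodState a c) {i : Fin n} (hi : c i ≠ 0) :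
    GoodState a (step a c i) := by
  have hself : SimplicialToric.step a c i i ≠ 0 →
      ¬critExp a i ∣ stepVal a c i ∧ SimplicialToric.step a c i i = stepVal a c i := by
    unfold SimplicialToric.step
    rw [Function.update_self]
    split_ifs with h <;> simp [h]
  have hdisj : ∀ j, j ≠ i → c j ≠ 0 → SimplicialToric.step a c i i ≠ 0 →
      SimplicialToric.step a c i i • a i ≠ c j • a j := by
    intro j hj hcj h0 heq
    obtain ⟨h1, h2⟩ := hself h0
    rw [h2] at heq h0
    obtain ⟨h3, h4⟩ := critExp_le (a := a) (i := i) (β := Pi.single j (c j)) h0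
      (by simp [hj.symm]) (by rw [wt_single, heq])
    have h5 := Nat.le_of_dvd (Nat.pos_of_ne_zero h3) (hc.stepVal_dvd hi)
    exact h1 (by rw [le_antisymm h4 h5])
  refine ⟨fun j l hj hl h => ?_, fun j hj => ?_, fun j hj hmj => ?_⟩
  · by_cases hji : j = i
    · by_cases hli : l = i
      · rw [hji, hli]
      · subst hji
        rw [step_of_ne hli] at h hl
        exact absurd h (hdisj l hli hl hj)
    · rw [step_of_ne hji] at h hj
      by_cases hli : l = i
      · subst hli
        exact absurd h.symm (hdisj j hji hj hl)
      · rw [step_of_ne hli] at h hl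
        exact hc.inj j l hj hl h
  · by_cases hji : j = i
    · subst hji
      rw [(hself hj).2]
      exact hc.stepVal_dvd hi
    · rw [step_of_ne hji] at hj ⊢
      exact hc.dvd j hj
  · obtain ⟨β, h1, h2, h3, -⟩ := hc.exists_crit_step hz H hi (r := ⊤)
      (fun l hl hml => by
        obtain ⟨β, h1, h2, h3⟩ := hc.crit l hl hml
        exact ⟨β, h1, h2, h3, trivial⟩) j hj hmj
    exact ⟨β, h1, h2, h3⟩

/-- One execution of the loop body is a step of the labelled state. -/
theorem reduceAt_config {a : Fin n → Fin m → ℕ} {c : Fin n → ℕ} (hc : GoodState a c) {i : Fin n}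
    (hi : c i ≠ 0) : reduceAt (config a c) (c i • a i) = config a (step a c i) := by
  classical
  set T := (config a c).erase (c i • a i) with hT
  have hTset : T = (Finset.univ.filter (fun j => c j ≠ 0 ∧ j ≠ i)).image (fun j => c j • a j) := by
    apply Finset.coe_injective
    rw [hT, coe_erase_config hc.inj hi]
    simp
  have hval : latticeIndex T (c i • a i) • c i • a i = stepVal a c i • a i := by
    rw [smul_smul, stepVal]
  have hmem : stepVal a c i • a i ∈ AddSubmonoid.closure (T : Set (Fin m → ℕ)) ↔
      critExp a i ∣ stepVal a c i := by
    rw [hT, mem_closure_erase_config_iff hc.inj hi]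
    constructor
    · rintro ⟨β, h1, h2, h3⟩
      by_cases h0 : stepVal a c i = 0
      · rw [h0]
        exact dvd_zero _
      · obtain ⟨h4, h5⟩ := critExp_le h0 h1 h3
        rw [le_antisymm h5 (Nat.le_of_dvd (Nat.pos_of_ne_zero h4) (hc.stepVal_dvd hi))]
    · intro h
      have hm := hc.critExp_eq_stepVal hi h
      by_cases h0 : critExp a i = 0
      · exact ⟨0, rfl, fun _ => dvd_zero _, by rw [← hm, h0]; simp⟩
      · rw [← hm]
        exact hc.crit i hi h0
  have hrat : stepVal a c i • a i ∉ AddSubmonoid.closure (T : Set (Fin m → ℕ)) →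
      InRatSpan T (c i • a i) := by
    intro hnot
    have hB : latticeIndex T (c i • a i) ≠ 0 := by
      intro h0
      rw [stepVal, ← hT, h0] at hnot
      exact hnot (by simp)
    have hBmem := (sInf_dvd_iff (AddSubgroup.closure ((fun v : Fin m → ℕ => fun l => (v l : ℤ)) ''
      (T : Set (Fin m → ℕ)))) (fun l => ((c i • a i) l : ℤ)) (latticeIndex T (c i • a i))).1 dvd_rfl
    -- an integral relation is a rational one
    let φ : (Fin m → ℤ) →+ (Fin m → ℚ) := (Int.castAddHom ℚ).compLeft (Fin m)
    have h1 : φ (latticeIndex T (c i • a i) • (fun l => ((c i • a i) l : ℤ))) ∈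
        Submodule.span ℚ ((fun v : Fin m → ℕ => fun l => (v l : ℚ)) '' (T : Set (Fin m → ℕ))) := by
      have h2 : AddSubgroup.closure ((fun v : Fin m → ℕ => fun l => (v l : ℤ)) ''
          (T : Set (Fin m → ℕ))) ≤ (Submodule.span ℚ ((fun v : Fin m → ℕ => fun l => (v l : ℚ)) ''
          (T : Set (Fin m → ℕ)))).toAddSubgroup.comap φ := by
        rw [AddSubgroup.closure_le]
        rintro _ ⟨v, hv, rfl⟩
        refine Submodule.subset_span ⟨v, hv, ?_⟩
        ext l
        simp [φ]
      exact h2 hBmem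
    rw [map_nsmul] at h1
    have h3 := Submodule.smul_mem _ ((latticeIndex T (c i • a i) : ℚ)⁻¹) h1
    rw [← Nat.cast_smul_eq_nsmul ℚ (latticeIndex T (c i • a i)) (φ _), smul_smul,
      inv_mul_cancel₀ (by exact_mod_cast hB),
      one_smul] at h3
    have h4 : (fun l => ((c i • a i) l : ℚ)) = φ (fun l => ((c i • a i) l : ℤ)) := by
      ext l
      simp [φ]
    rw [InRatSpan, h4]
    exact h3
  unfold reduceAt
  rw [← hT, hval]
  by_cases hd : critExp a i ∣ stepVal a c i
  · rw [if_neg (by rw [hmem]; simp [hd]), hTset, config]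
    ext x
    simp only [Finset.mem_image, Finset.mem_filter, Finset.mem_univ, true_and]
    constructor
    · rintro ⟨j, ⟨h1, h2⟩, rfl⟩
      exact ⟨j, by rwa [step_of_ne h2], by rw [step_of_ne h2]⟩
    · rintro ⟨j, h1, rfl⟩
      have h2 : j ≠ i := by
        rintro rfl
        simp [step, hd] at h1
      rw [step_of_ne h2] at h1 ⊢
      exact ⟨j, ⟨h1, h2⟩, rfl⟩
  · have hn := mt hmem.1 hd
    rw [if_pos ⟨hrat hn, hn⟩, hTset, config]
    have hs : step a c i i = stepVal a c i := by simp [step, hd]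
    have hs0 : stepVal a c i ≠ 0 := by
      intro h0
      exact hd (by rw [h0]; exact dvd_zero _)
    ext x
    simp only [Finset.mem_insert, Finset.mem_image, Finset.mem_filter, Finset.mem_univ, true_and]
    constructor
    · rintro (rfl | ⟨j, ⟨h1, h2⟩, rfl⟩)
      · exact ⟨i, by rwa [hs], by rw [hs]⟩
      · exact ⟨j, by rwa [step_of_ne h2], by rw [step_of_ne h2]⟩
    · rintro ⟨j, h1, rfl⟩
      by_cases h2 : j = i
      · subst h2
        exact Or.inl (by rw [hs])
      · rw [step_of_ne h2] at h1 ⊢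
        exact Or.inr ⟨j, ⟨h1, h2⟩, rfl⟩

/-- A state that a whole pass leaves unchanged: no vector can be removed and all lattice indices
are `1`. -/
def Stable (a : Fin n → Fin m → ℕ) (r : Fin n → ℕ) : Prop :=
  ∀ i, r i ≠ 0 → ¬critExp a i ∣ r i ∧ Dep a r i (r i)

/-- A stable state that is a multiple of a given state is a multiple of all its descendants. This is
why the output does not depend on the orders chosen: it is the least such state for divisibility. -/
theorem Stable.step_dvd {a : Fin n → Fin m → ℕ} {r c : Fin n → ℕ} (hr : Stable a r)
    (hc : InjState a c) (h : ∀ j, c j ∣ r j) {i : Fin n} (hi : c i ≠ 0) (j : Fin n) :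
    step a c i j ∣ r j := by
  by_cases hj : j = i
  · subst hj
    by_cases h0 : r j = 0
    · rw [h0]
      exact dvd_zero _
    obtain ⟨h1, γ, h2, h3, h4⟩ := hr j h0
    have hdv : stepVal a c j ∣ r j := (stepVal_dvd_iff hc hi _).2
      ⟨h j, γ, h2, fun l => (Int.natCast_dvd_natCast.2 (h l)).trans (h3 l), h4⟩
    have hn : ¬critExp a j ∣ stepVal a c j := fun h5 => h1 (h5.trans hdv)
    simpa [step, hn] using hdv
  · rw [step_of_ne hj]
    exact h j

theorem dep_of_step_eq {a : Fin n → Fin m → ℕ} {c : Fin n → ℕ} (hc : InjState a c) {i : Fin n}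
    (hi : c i ≠ 0) (h : step a c i = c) : ¬critExp a i ∣ c i ∧ Dep a c i (c i) := by
  have h1 := congrFun h i
  by_cases hd : critExp a i ∣ stepVal a c i
  · simp only [step, hd, if_true, Function.update_self] at h1
    exact absurd h1.symm hi
  · simp only [step, hd, if_false, Function.update_self] at h1
    exact ⟨h1 ▸ hd, ((stepVal_dvd_iff hc hi (c i)).1 (by rw [h1])).2⟩

/-! ### The output of the reduction algorithm: existence and uniqueness -/

/-- The state `c'` arises from `c` by finitely many steps. -/
def Reach (a : Fin n → Fin m → ℕ) : (Fin n → ℕ) → (Fin n → ℕ) → Prop :=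
  Relation.ReflTransGen (fun c c' => ∃ i, c i ≠ 0 ∧ c' = step a c i)

theorem Reach.good {a : Fin n → Fin m → ℕ} (hz : ∀ i, a i ≠ 0) (H : CritDistinct a)
    {c c' : Fin n → ℕ} (h : Reach a c c') (hc : GoodState a c) : GoodState a c' := by
  induction h with
  | refl => exact hc
  | tail _ h ih =>
    obtain ⟨i, hi, rfl⟩ := h
    exact ih.step hz H hi

theorem Reach.dvd {a : Fin n → Fin m → ℕ} {c c' : Fin n → ℕ} (h : Reach a c c') (j : Fin n) :
    c j ∣ c' j := by
  induction h with
  | refl => exact dvd_rfl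
  | tail _ h ih =>
    obtain ⟨i, hi, rfl⟩ := h
    exact ih.trans (dvd_step i j)

theorem Stable.reach_dvd {a : Fin n → Fin m → ℕ} (hz : ∀ i, a i ≠ 0) (H : CritDistinct a)
    {r c c' : Fin n → ℕ} (hr : Stable a r) (hc : GoodState a c) (h : Reach a c c')
    (hd : ∀ j, c j ∣ r j) : ∀ j, c' j ∣ r j := by
  induction h with
  | refl => exact hd
  | tail h1 h ih =>
    obtain ⟨i, hi, rfl⟩ := h
    exact hr.step_dvd (Reach.good hz H h1 hc).inj ih hi

theorem foldl_reduceAt_config {a : Fin n → Fin m → ℕ} (hz : ∀ i, a i ≠ 0) (H : CritDistinct a)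
    (l : List (Fin n)) : ∀ {c : Fin n → ℕ}, l.Nodup → (∀ i ∈ l, c i ≠ 0) → GoodState a c →
      (l.map (fun i => c i • a i)).foldl reduceAt (config a c) =
        config a (l.foldl (step a) c) ∧ Reach a c (l.foldl (step a) c) := by
  induction l with
  | nil => exact fun _ _ _ => ⟨rfl, Relation.ReflTransGen.refl⟩
  | cons i l ih =>
    intro c hl hc hg
    rw [List.nodup_cons] at hl
    have hi := hc i (by simp)
    have hne : ∀ j ∈ l, j ≠ i := by
      rintro j hj rfl
      exact hl.1 hj
    obtain ⟨h1, h2⟩ := ih (c := step a c i) hl.2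
      (fun j hj => by rw [step_of_ne (hne j hj)]; exact hc j (by simp [hj])) (hg.step hz H hi)
    refine ⟨?_, Relation.ReflTransGen.head ⟨i, hi, rfl⟩ h2⟩
    rw [List.map_cons, List.foldl_cons, List.foldl_cons, reduceAt_config hg hi, ← h1]
    congr 1
    refine List.map_congr_left fun j hj => ?_
    rw [step_of_ne (hne j hj)]

theorem mem_config {a : Fin n → Fin m → ℕ} {c : Fin n → ℕ} {x : Fin m → ℕ} :
    x ∈ config a c ↔ ∃ i, c i ≠ 0 ∧ c i • a i = x := by
  simp [config]

theorem config_eq_empty {a : Fin n → Fin m → ℕ} {c : Fin n → ℕ} : config a c = ∅ ↔ c = 0 := by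
  constructor
  · intro h
    ext i
    by_contra hi
    exact Finset.notMem_empty (c i • a i) (h ▸ mem_config.2 ⟨i, hi, rfl⟩)
  · rintro rfl
    simp [config]

theorem exists_labels_of_pass {a : Fin n → Fin m → ℕ} (hz : ∀ i, a i ≠ 0) (H : CritDistinct a)
    {c : Fin n → ℕ} (hc : GoodState a c) {G : Finset (Fin m → ℕ)}
    (h : ReductionPass (config a c) G) :
    ∃ l : List (Fin n), l.Nodup ∧ (∀ i, i ∈ l ↔ c i ≠ 0) ∧ G = config a (l.foldl (step a) c) := by
  obtain ⟨L, hL, hLc, rfl⟩ := h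
  have hex : ∀ x ∈ L, ∃ i, c i ≠ 0 ∧ c i • a i = x := fun x hx =>
    mem_config.1 (hLc ▸ List.mem_toFinset.2 hx)
  obtain ⟨l, hl1, hl2⟩ : ∃ l : List (Fin n), (∀ i ∈ l, c i ≠ 0) ∧
      l.map (fun i => c i • a i) = L := by
    clear hL hLc
    induction L with
    | nil => exact ⟨[], by simp, rfl⟩
    | cons x L ih =>
      obtain ⟨l, h1, h2⟩ := ih fun y hy => hex y (by simp [hy])
      obtain ⟨i, h3, h4⟩ := hex x (by simp)
      exact ⟨i :: l, by simpa [h3] using h1, by rw [List.map_cons, h2, h4]⟩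
  have hnd : l.Nodup := List.Nodup.of_map _ (hl2 ▸ hL)
  refine ⟨l, hnd, fun i => ⟨hl1 i, fun hi => ?_⟩, ?_⟩
  · have : c i • a i ∈ L := by
      rw [← List.mem_toFinset, hLc]
      exact mem_config.2 ⟨i, hi, rfl⟩
    rw [← hl2, List.mem_map] at this
    obtain ⟨j, hj, hji⟩ := this
    rwa [← hc.inj j i (hl1 j hj) hi hji]
  · rw [← hl2, (foldl_reduceAt_config hz H l hnd hl1 hc).1]

theorem reductionPass_config {a : Fin n → Fin m → ℕ} (hz : ∀ i, a i ≠ 0) (H : CritDistinct a)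
    {c : Fin n → ℕ} (hc : GoodState a c) {l : List (Fin n)} (hl : l.Nodup)
    (hmem : ∀ i, i ∈ l ↔ c i ≠ 0) :
    ReductionPass (config a c) (config a (l.foldl (step a) c)) := by
  refine ⟨l.map (fun i => c i • a i), ?_, ?_,
    ((foldl_reduceAt_config hz H l hl (fun i hi => (hmem i).1 hi) hc).1).symm⟩
  · exact List.Nodup.map_on (fun i hi j hj h => hc.inj i j ((hmem i).1 hi) ((hmem j).1 hj) h) hl
  · ext x
    simp [mem_config, hmem]

/-- The number of vectors and the sum of their entries determine whether a state has changed. -/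
theorem eq_of_config_eq {a : Fin n → Fin m → ℕ} (hz : ∀ i, a i ≠ 0) {c c' : Fin n → ℕ}
    (hc : GoodState a c) (hc' : GoodState a c') (hd : ∀ j, c j ∣ c' j)
    (h : config a c' = config a c) : c' = c := by
  have hsub : (Finset.univ.filter (fun i => c' i ≠ 0)) ⊆ Finset.univ.filter (fun i => c i ≠ 0) := by
    intro i
    simp only [Finset.mem_filter, Finset.mem_univ, true_and]
    intro h1 h2
    exact h1 (zero_dvd_iff.1 (h2 ▸ hd i))
  have hinj : ∀ {c : Fin n → ℕ}, GoodState a c → Set.InjOn (fun i => c i • a i)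
      (Finset.univ.filter (fun i => c i ≠ 0) : Finset (Fin n)) := by
    intro c hc i hi j hj hij
    simp only [Finset.coe_filter, Finset.mem_univ, true_and, Set.mem_ofPred_eq] at hi hj
    exact hc.inj i j hi hj hij
  have halive : (Finset.univ.filter (fun i => c' i ≠ 0)) =
      Finset.univ.filter (fun i => c i ≠ 0) := by
    refine Finset.eq_of_subset_of_card_le hsub ?_
    have := congrArg Finset.card h
    rw [config, config, Finset.card_image_of_injOn (hinj hc),
      Finset.card_image_of_injOn (hinj hc')] at this
    exact this.ge
  have hsum : ∑ i with c i ≠ 0, ∑ l, (c i • a i) l = ∑ i with c i ≠ 0, ∑ l, (c' i • a i) l := by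
    have h1 := congrArg (fun S : Finset (Fin m → ℕ) => ∑ x ∈ S, ∑ l, x l) h
    simp only [config] at h1
    rw [Finset.sum_image (hinj hc), Finset.sum_image (hinj hc'), halive] at h1
    exact h1.symm
  have hle : ∀ i, c' i ≠ 0 → c i ≤ c' i := fun i hi => Nat.le_of_dvd (Nat.pos_of_ne_zero hi) (hd i)
  have hmem : ∀ i, c i ≠ 0 → c' i ≠ 0 := by
    intro i hi
    have : i ∈ Finset.univ.filter (fun i => c' i ≠ 0) := by simp [halive, hi]
    simpa using this
  ext i
  by_cases hi : c i = 0
  · have := hd i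
    rw [hi, zero_dvd_iff] at this
    rw [hi, this]
  by_contra hne
  refine absurd hsum (Finset.sum_lt_sum (fun j hj => ?_) ⟨i, by simpa using hi, ?_⟩).ne
  · have := hle j (hmem j (by simpa using hj))
    exact Finset.sum_le_sum fun l _ => Nat.mul_le_mul_right _ this
  · have hlt : c i < c' i := lt_of_le_of_ne (hle i (hmem i hi)) (Ne.symm hne)
    obtain ⟨l, hl⟩ := Function.ne_iff.1 (hz i)
    exact Finset.sum_lt_sum (fun l _ => Nat.mul_le_mul_right _ hlt.le)
      ⟨l, Finset.mem_univ l, Nat.mul_lt_mul_of_pos_right hlt (Nat.pos_of_ne_zero hl)⟩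

theorem dvd_foldl_step {a : Fin n → Fin m → ℕ} (l : List (Fin n)) (c : Fin n → ℕ) (j : Fin n) :
    c j ∣ l.foldl (step a) c j := by
  induction l generalizing c with
  | nil => exact dvd_rfl
  | cons i l ih => exact (dvd_step i j).trans (ih _)

theorem step_eq_of_foldl_eq {a : Fin n → Fin m → ℕ} {c : Fin n → ℕ} {l : List (Fin n)}
    (h : l.foldl (step a) c = c) : ∀ i ∈ l, step a c i = c := by
  induction l with
  | nil => simp
  | cons i l ih =>
    rw [List.foldl_cons] at h
    have hi : step a c i = c := by
      ext j
      refine Nat.dvd_antisymm ?_ (dvd_step i j)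
      have := dvd_foldl_step (a := a) l (step a c i) j
      rwa [h] at this
    rw [hi] at h
    intro j hj
    rcases List.mem_cons.1 hj with rfl | hj
    · exact hi
    · exact ih h j hj

/-- Every output of the algorithm is given by a stable state reached by steps. -/
theorem IsReduction.exists_state {a : Fin n → Fin m → ℕ} (hz : ∀ i, a i ≠ 0)
    (H : CritDistinct a) {G R : Finset (Fin m → ℕ)} (h : IsReduction G R) :
    ∀ {c : Fin n → ℕ}, GoodState a c → G = config a c →
      ∃ c', Reach a c c' ∧ Stable a c' ∧ R = config a c' := by
  induction h with
  | @last G R pass h =>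
    rintro c hc rfl
    obtain ⟨l, hl, hmem, rfl⟩ := exists_labels_of_pass hz H hc pass
    have hr := (foldl_reduceAt_config hz H l hl (fun i hi => (hmem i).1 hi) hc).2
    refine ⟨_, hr, ?_, rfl⟩
    rcases h with h | h
    · rw [config_eq_empty.1 h]
      intro i hi
      exact absurd rfl hi
    · have heq := eq_of_config_eq hz hc (hr.good hz H hc) hr.dvd h
      rw [heq]
      intro i hi
      exact dep_of_step_eq hc.inj hi (step_eq_of_foldl_eq heq i ((hmem i).2 hi))
  | @again G G' R pass h rest ih =>
    rintro c hc rfl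
    obtain ⟨l, hl, hmem, rfl⟩ := exists_labels_of_pass hz H hc pass
    have hr := (foldl_reduceAt_config hz H l hl (fun i hi => (hmem i).1 hi) hc).2
    obtain ⟨c', h1, h2, h3⟩ := ih (hr.good hz H hc) rfl
    exact ⟨c', hr.trans h1, h2, h3⟩

/-- Relations with nonzero coefficients at each single index of `E` combine to one relation with
nonzero coefficients at all of them. -/
theorem exists_full_relation {K : AddSubgroup (Fin n → ℤ)} (E : Finset (Fin n))
    (h : ∀ i ∈ E, ∃ u ∈ K, u i ≠ 0) : ∃ u ∈ K, ∀ i ∈ E, u i ≠ 0 := by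
  classical
  induction E using Finset.induction_on with
  | empty => exact ⟨0, K.zero_mem, by simp⟩
  | insert i E _ ih =>
    obtain ⟨u, hu, hu0⟩ := ih fun j hj => h j (by simp [hj])
    obtain ⟨v, hv, hv0⟩ := h i (by simp)
    -- a multiplier exceeding all entries of `v`, so that no cancellation occurs
    set N : ℕ := 1 + ∑ j, (v j).natAbs with hN
    have hlt : ∀ j, (v j).natAbs < N := fun j => by
      have := Finset.single_le_sum (f := fun j => (v j).natAbs) (fun _ _ => Nat.zero_le _)
        (Finset.mem_univ j)
      omega
    refine ⟨(N : ℤ) • u + v, K.add_mem (K.zsmul_mem hu _) hv, fun j hj h0 => ?_⟩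
    have h1 : (N : ℤ) * u j = -v j := by
      have : (N : ℤ) * u j + v j = 0 := by simpa using h0
      omega
    have h2 := congrArg Int.natAbs h1
    rw [Int.natAbs_mul, Int.natAbs_natCast, Int.natAbs_neg] at h2
    have h3 := hlt j
    have huj : u j = 0 := by
      by_contra hne
      have : 0 < (u j).natAbs := Int.natAbs_pos.2 hne
      nlinarith
    rcases Finset.mem_insert.1 hj with rfl | hj
    · rw [huj, mul_zero] at h1
      exact hv0 (by omega)
    · exact hu0 j hj huj

/-- The integral relations of `a` that are relations of the vectors `c j • a j`. -/
def relations (a : Fin n → Fin m → ℕ) (c : Fin n → ℕ) : AddSubgroup (Fin n → ℤ) where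
  carrier := {u | zwt a u = 0 ∧ ∀ j, (c j : ℤ) ∣ u j}
  zero_mem' := ⟨map_zero _, fun _ => dvd_zero _⟩
  add_mem' hu hv := ⟨by rw [map_add, hu.1, hv.1, add_zero], fun j => dvd_add (hu.2 j) (hv.2 j)⟩
  neg_mem' hu := ⟨by rw [map_neg, hu.1, neg_zero], fun j => (dvd_neg).2 (hu.2 j)⟩

theorem dep_iff_exists_relation {a : Fin n → Fin m → ℕ} {c : Fin n → ℕ} {i : Fin n} {z : ℤ}
    (hz : (c i : ℤ) ∣ z) : Dep a c i z ↔ ∃ u ∈ relations a c, u i = z := by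
  constructor
  · rintro ⟨γ, h1, h2, h3⟩
    refine ⟨Pi.single i z - γ, ⟨?_, fun j => dvd_sub ?_ (h2 j)⟩, by simp [h1]⟩
    · rw [map_sub, zwt_single, h3, sub_self]
    · by_cases hj : j = i
      · subst hj; simpa using hz
      · simp [hj]
  · rintro ⟨u, ⟨h1, h2⟩, rfl⟩
    refine ⟨Pi.single i (u i) - u, by simp, fun j => dvd_sub ?_ (h2 j), ?_⟩
    · by_cases hj : j = i
      · subst hj; simpa using hz
      · simp [hj]
    · rw [map_sub, zwt_single, h1, sub_zero]

theorem step_dvd_relation {a : Fin n → Fin m → ℕ} {c : Fin n → ℕ} (hc : InjState a c) {i : Fin n}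
    (hi : c i ≠ 0) {u : Fin n → ℤ} (hu : u ∈ relations a c) (hs : step a c i i ≠ 0) (j : Fin n) :
    (step a c i j : ℤ) ∣ u j := by
  by_cases hj : j = i
  · subst hj
    have hd : ¬critExp a j ∣ stepVal a c j := by
      intro hd
      simp [step, hd] at hs
    have h1 : stepVal a c j ∣ (u j).natAbs := by
      refine (stepVal_dvd_iff hc hi _).2 ⟨Int.natCast_dvd.1 (hu.2 j), ?_⟩
      rcases Int.natAbs_eq (u j) with h | h
      · exact (dep_iff_exists_relation (h ▸ hu.2 j)).2 ⟨u, hu, h⟩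
      · have h' : ((u j).natAbs : ℤ) = (-u) j := by
          rw [Pi.neg_apply]
          omega
        exact (dep_iff_exists_relation (h' ▸ ((dvd_neg).2 (hu.2 j)))).2 ⟨-u, neg_mem hu, h'.symm⟩
    simpa [step, hd] using Int.natCast_dvd.2 h1
  · rw [step_of_ne hj]
    exact hu.2 j

/-- A relation of the current vectors stays one as long as no vector is removed. -/
theorem Reach.removal_or_relation {a : Fin n → Fin m → ℕ} (hz : ∀ i, a i ≠ 0)
    (H : CritDistinct a) {c c' : Fin n → ℕ} (hc : GoodState a c) (h : Reach a c c')
    {u : Fin n → ℤ} (hu : u ∈ relations a c) :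
    (∃ i, c i ≠ 0 ∧ c' i = 0) ∨ u ∈ relations a c' := by
  induction h with
  | refl => exact Or.inr hu
  | @tail d e h1 h ih =>
    obtain ⟨i, hi, rfl⟩ := h
    have hci : c i ≠ 0 := by
      intro h0
      exact hi (zero_dvd_iff.1 (h0 ▸ Reach.dvd h1 i))
    rcases ih with ⟨j, hj, hj0⟩ | ih
    · refine Or.inl ⟨j, hj, ?_⟩
      have := dvd_step (a := a) (c := d) i j
      rwa [hj0, zero_dvd_iff] at this
    · by_cases hs : step a d i i = 0
      · exact Or.inl ⟨i, hci, hs⟩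
      · exact Or.inr ⟨hu.1, step_dvd_relation (Reach.good hz H h1 hc).inj hi ih hs⟩

/-- A vector without relations to the others is removed when it is treated. -/
theorem step_self_eq_zero {a : Fin n → Fin m → ℕ} {c d : Fin n → ℕ} (hd : InjState a d)
    (hcd : ∀ j, c j ∣ d j) {i : Fin n} (h : ∀ u ∈ relations a c, u i = 0) :
    step a d i i = 0 := by
  have hval : stepVal a d i = 0 := by
    by_cases hi : d i = 0
    · simp [stepVal, hi]
    obtain ⟨h1, h2⟩ := (stepVal_dvd_iff hd hi _).1 dvd_rfl
    obtain ⟨u, hu, h3⟩ := (dep_iff_exists_relation (Int.natCast_dvd_natCast.2 h1)).1 h2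
    have := h u ⟨hu.1, fun j => (Int.natCast_dvd_natCast.2 (hcd j)).trans (hu.2 j)⟩
    rw [h3] at this
    exact_mod_cast this
  simp [step, hval]

theorem foldl_step_eq_zero {a : Fin n → Fin m → ℕ} (hz : ∀ i, a i ≠ 0) (H : CritDistinct a)
    {c : Fin n → ℕ} {i : Fin n} (h : ∀ u ∈ relations a c, u i = 0) (l : List (Fin n)) :
    ∀ {d : Fin n → ℕ}, GoodState a d → (∀ j, c j ∣ d j) → l.Nodup → (∀ j ∈ l, d j ≠ 0) → i ∈ l →
      l.foldl (step a) d i = 0 := by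
  induction l with
  | nil => simp
  | cons j l ih =>
    intro d hd hcd hl hne hi
    rw [List.nodup_cons] at hl
    rw [List.foldl_cons]
    by_cases hij : i = j
    · subst hij
      have := dvd_foldl_step (a := a) l (step a d i) i
      rwa [step_self_eq_zero hd.inj hcd h, zero_dvd_iff] at this
    · refine ih (hd.step hz H (hne j (by simp))) (fun k => (hcd k).trans (dvd_step j k)) hl.2
        (fun k hk => ?_) ((List.mem_cons.1 hi).resolve_left hij)
      have hkj : k ≠ j := by
        rintro rfl
        exact hl.1 hk
      rw [step_of_ne hkj]
      exact hne k (by simp [hk])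

/-- The algorithm terminates: as long as nothing is removed, the multipliers are bounded by a
relation all of whose coefficients are nonzero. -/
theorem exists_isReduction {a : Fin n → Fin m → ℕ} (hz : ∀ i, a i ≠ 0) (H : CritDistinct a) :
    ∀ (N : ℕ) {c : Fin n → ℕ}, GoodState a c → (Finset.univ.filter (fun i => c i ≠ 0)).card = N →
      ∃ R, IsReduction (config a c) R := by
  intro N
  induction N using Nat.strong_induction_on with
  | _ N IH =>
  -- one pass, whose result is handed to `hrest` if a further pass is needed
  have pass : ∀ {c : Fin n → ℕ}, GoodState a c →
      (∀ c', GoodState a c' → Reach a c c' → c' ≠ c →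
        (∀ i, c i ≠ 0 → (∀ u ∈ relations a c, u i = 0) → c' i = 0) →
        ∃ R, IsReduction (config a c') R) → ∃ R, IsReduction (config a c) R := by
    intro c hc hrest
    set l := (Finset.univ.filter (fun i => c i ≠ 0)).toList with hl
    have hnd : l.Nodup := Finset.nodup_toList _
    have hmem : ∀ i, i ∈ l ↔ c i ≠ 0 := by simp [hl]
    have hp := reductionPass_config hz H hc hnd hmem
    have hr := (foldl_reduceAt_config hz H l hnd (fun i hi => (hmem i).1 hi) hc).2
    by_cases hfin : config a (l.foldl (step a) c) = ∅ ∨ config a (l.foldl (step a) c) = config a c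
    · exact ⟨_, IsReduction.last hp hfin⟩
    · obtain ⟨R, hR⟩ := hrest _ (hr.good hz H hc) hr
        (fun h => hfin (Or.inr (by rw [h]))) (fun i hi hu =>
          foldl_step_eq_zero hz H hu l hc (fun _ => dvd_rfl) hnd (fun j hj => (hmem j).1 hj)
            ((hmem i).2 hi))
      exact ⟨R, IsReduction.again hp hfin hR⟩
  have hless : ∀ {c c' : Fin n → ℕ}, (∀ j, c j ∣ c' j) →
      (Finset.univ.filter (fun i => c i ≠ 0)).card = N → (∃ i, c i ≠ 0 ∧ c' i = 0) →
      (Finset.univ.filter (fun i => c' i ≠ 0)).card < N := by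
    rintro c c' hd rfl ⟨i, hi, hi'⟩
    refine Finset.card_lt_card ⟨fun j => ?_, fun hsub => ?_⟩
    · simp only [Finset.mem_filter, Finset.mem_univ, true_and]
      intro h1 h2
      exact h1 (zero_dvd_iff.1 (h2 ▸ hd j))
    · have := hsub (Finset.mem_filter.2 ⟨Finset.mem_univ i, hi⟩)
      simp [hi'] at this
  have bounded : ∀ (u : Fin n → ℤ) (K : ℕ) {c : Fin n → ℕ}, GoodState a c →
      (Finset.univ.filter (fun i => c i ≠ 0)).card = N → u ∈ relations a c →
      (∀ i, c i ≠ 0 → u i ≠ 0) → ∑ i, (u i).natAbs ≤ ∑ i, c i + K →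
      ∃ R, IsReduction (config a c) R := by
    intro u K
    induction K using Nat.strong_induction_on with
    | _ K IHK =>
    intro c hc hN hu hu0 hK
    refine pass hc fun c' hc' hr hne _ => ?_
    rcases hr.removal_or_relation hz H hc hu with hrem | hu'
    · exact IH _ (hless hr.dvd hN hrem) hc' rfl
    have hle' : ∀ i, c' i ≤ (u i).natAbs ∧ c i ≤ c' i := by
      intro i
      by_cases hci : c i = 0
      · have := hr.dvd i
        rw [hci, zero_dvd_iff] at this
        simp [hci, this]
      · have h1 : c' i ∣ (u i).natAbs := Int.natCast_dvd.1 (hu'.2 i)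
        have h2 : 0 < (u i).natAbs := Int.natAbs_pos.2 (hu0 i hci)
        exact ⟨Nat.le_of_dvd h2 h1, Nat.le_of_dvd (Nat.pos_of_dvd_of_pos h1 h2) (hr.dvd i)⟩
    have hlt : ∑ i, c i < ∑ i, c' i := by
      obtain ⟨i, hi⟩ := Function.ne_iff.1 hne
      exact Finset.sum_lt_sum (fun i _ => (hle' i).2)
        ⟨i, Finset.mem_univ i, lt_of_le_of_ne (hle' i).2 (Ne.symm hi)⟩
    have hle : ∑ i, c' i ≤ ∑ i, (u i).natAbs := Finset.sum_le_sum fun i _ => (hle' i).1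
    have hu0' : ∀ i, c' i ≠ 0 → u i ≠ 0 := by
      intro i hi
      refine hu0 i fun h0 => hi ?_
      have := hr.dvd i
      rwa [h0, zero_dvd_iff] at this
    by_cases hrem : ∃ i, c i ≠ 0 ∧ c' i = 0
    · exact IH _ (hless hr.dvd hN hrem) hc' rfl
    · push Not at hrem
      refine IHK (K - (∑ i, c' i - ∑ i, c i)) (by omega) hc' ?_ hu' hu0' (by omega)
      rw [← hN]
      congr 1
      ext i
      simp only [Finset.mem_filter, Finset.mem_univ, true_and]
      refine ⟨fun h1 h2 => h1 ?_, hrem i⟩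
      have := hr.dvd i
      rwa [h2, zero_dvd_iff] at this
  intro c hc hN
  by_cases hfull : ∀ i ∈ Finset.univ.filter (fun i => c i ≠ 0), ∃ u ∈ relations a c, u i ≠ 0
  · obtain ⟨u, hu, hu0⟩ := exists_full_relation _ hfull
    exact bounded u (∑ i, (u i).natAbs) hc hN hu (fun i hi => hu0 i (by simpa using hi))
      (Nat.le_add_left _ _)
  · push Not at hfull
    obtain ⟨i, hi, hui⟩ := hfull
    have hi : c i ≠ 0 := by simpa using hi
    exact pass hc fun c' hc' hr _ hz' => IH _ (hless hr.dvd hN ⟨i, hi, hz' i hi hui⟩) hc' rfl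

theorem config_one (a : Fin n → Fin m → ℕ) :
    config a (fun _ => 1) = Finset.univ.image a := by
  simp [config]

/-- All runs of the algorithm end in the same state. -/
theorem exists_output {a : Fin n → Fin m → ℕ} (hz : ∀ i, a i ≠ 0)
    (ha : Function.Injective a) (H : CritDistinct a) :
    ∃ r, Reach a (fun _ => 1) r ∧ Stable a r ∧
      ∀ R, IsReduction (Finset.univ.image a) R ↔ R = config a r := by
  have hg := goodState_one ha
  obtain ⟨R, hR⟩ := exists_isReduction hz H _ hg rfl
  obtain ⟨r, h1, h2, rfl⟩ := hR.exists_state hz H hg rfl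
  rw [config_one] at hR
  refine ⟨r, h1, h2, fun R' => ⟨fun hR' => ?_, fun h => h ▸ hR⟩⟩
  obtain ⟨r', g1, g2, rfl⟩ := hR'.exists_state hz H hg (config_one a).symm
  congr 1
  ext i
  exact Nat.dvd_antisymm (h2.reach_dvd hz H hg g1 (fun _ => one_dvd _) i)
    (g2.reach_dvd hz H hg h1 (fun _ => one_dvd _) i)

/-! ### Binomials in the toric ideal -/

open MvPolynomial

variable {k : Type*} [Field k]

/-- The monomial with exponent vector `u`. -/
noncomputable def xpow (k : Type*) [Field k] {n : ℕ} (u : Fin n → ℕ) : MvPolynomial (Fin n) k :=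
  ∏ i, X i ^ u i

theorem monomial_eq_xpow (u : Fin n →₀ ℕ) : monomial u (1 : k) = xpow k u := by
  rw [xpow, monomial_eq, C_1, one_mul, Finsupp.prod_fintype _ _ (by simp)]

theorem xpow_eq_monomial (u : Fin n → ℕ) :
    xpow k u = monomial (Finsupp.equivFunOnFinite.symm u) 1 := by
  rw [monomial_eq_xpow]
  rfl

theorem xpow_add (u v : Fin n → ℕ) : xpow k (u + v) = xpow k u * xpow k v := by
  simp [xpow, pow_add, Finset.prod_mul_distrib]

@[simp]
theorem xpow_single (i : Fin n) (b : ℕ) : xpow k (Pi.single i b : Fin n → ℕ) = X i ^ b := by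
  rw [xpow, Finset.prod_eq_single i] <;> simp +contextual

theorem coeff_xpow (u v : Fin n → ℕ) :
    coeff (Finsupp.equivFunOnFinite.symm v) (xpow k u) = if u = v then 1 else 0 := by
  classical
  rw [xpow_eq_monomial, coeff_monomial]
  simp

theorem xpow_injective : Function.Injective (xpow k : (Fin n → ℕ) → _) := by
  intro u v h
  have := coeff_xpow (k := k) u v
  rw [h, coeff_xpow] at this
  by_contra hne
  simp [hne] at this

/-- The homomorphism `x_i ↦ t ^ (a i)`. -/
noncomputable def toricHom (k : Type*) [Field k] {n m : ℕ} (a : Fin n → Fin m → ℕ) :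
    MvPolynomial (Fin n) k →ₐ[k] MvPolynomial (Fin m) k :=
  aeval (fun i => xpow k (a i))

theorem mem_toricIdeal {a : Fin n → Fin m → ℕ} {f : MvPolynomial (Fin n) k} :
    f ∈ toricIdeal k a ↔ toricHom k a f = 0 := Iff.rfl

theorem toricHom_xpow (a : Fin n → Fin m → ℕ) (u : Fin n → ℕ) :
    toricHom k a (xpow k u) = xpow k (wt a u) := by
  simp only [toricHom, xpow, map_prod, map_pow, aeval_X, wt_apply]
  simp_rw [← Finset.prod_pow, ← pow_mul]
  rw [Finset.prod_comm]
  refine Finset.prod_congr rfl fun l _ => ?_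
  rw [Finset.prod_pow_eq_pow_sum]
  simp_rw [mul_comm]

theorem sub_mem_toricIdeal_iff {a : Fin n → Fin m → ℕ} {u v : Fin n → ℕ} :
    xpow k u - xpow k v ∈ toricIdeal k a ↔ wt a u = wt a v := by
  rw [mem_toricIdeal, map_sub, toricHom_xpow, toricHom_xpow, sub_eq_zero, xpow_injective.eq_iff]

theorem toricIdeal_isPrime (a : Fin n → Fin m → ℕ) : (toricIdeal k a).IsPrime :=
  RingHom.ker_isPrime _

/-- The toric ideal is generated by its binomials. -/
theorem toricIdeal_le {a : Fin n → Fin m → ℕ} {J : Ideal (MvPolynomial (Fin n) k)}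
    (h : ∀ u v : Fin n → ℕ, wt a u = wt a v → xpow k u - xpow k v ∈ J) : toricIdeal k a ≤ J := by
  intro g hg
  -- a linear section of the toric homomorphism on the monomials
  let Ψ : MvPolynomial (Fin m) k →ₗ[k] MvPolynomial (Fin n) k :=
    (basisMonomials (Fin m) k).constr k (fun e => xpow k (Function.invFun (wt a) e))
  have hΨ : ∀ e : Fin m → ℕ, Ψ (xpow k e) = xpow k (Function.invFun (wt a) e) := by
    intro e
    have h1 := (basisMonomials (Fin m) k).constr_basis k
      (fun e => xpow k (Function.invFun (wt a) e)) (Finsupp.equivFunOnFinite.symm e)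
    rw [coe_basisMonomials] at h1
    rw [xpow_eq_monomial e]
    exact h1
  have key : ∀ g : MvPolynomial (Fin n) k, g - Ψ (toricHom k a g) ∈ J := by
    intro g
    induction g using MvPolynomial.induction_on' with
    | monomial u c =>
      have h1 : monomial u c = c • xpow k u := by
        rw [← monomial_eq_xpow, smul_monomial, smul_eq_mul, mul_one]
      rw [h1, map_smul, map_smul, ← smul_sub, toricHom_xpow, hΨ]
      refine Submodule.smul_of_tower_mem J c (h _ _ ?_)
      exact (Function.invFun_eq ⟨_, rfl⟩).symm
    | add p q hp hq =>
      rw [map_add, map_add, add_sub_add_comm]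
      exact J.add_mem hp hq
  have := key g
  rwa [mem_toricIdeal.1 hg, map_zero, sub_zero] at this

/-- An element of the toric ideal has coefficient `0` at a monomial that is alone in its degree. -/
theorem coeff_eq_zero_of_mem_toricIdeal {a : Fin n → Fin m → ℕ} {v : Fin n → ℕ}
    (hv : ∀ u, wt a u = wt a v → u = v) {g : MvPolynomial (Fin n) k} (hg : g ∈ toricIdeal k a) :
    coeff (Finsupp.equivFunOnFinite.symm v) g = 0 := by
  have key : ∀ g : MvPolynomial (Fin n) k,
      coeff (Finsupp.equivFunOnFinite.symm (wt a v)) (toricHom k a g) =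
        coeff (Finsupp.equivFunOnFinite.symm v) g := by
    intro g
    induction g using MvPolynomial.induction_on' with
    | monomial u c =>
      have h1 : monomial u c = c • xpow k u := by
        rw [← monomial_eq_xpow, smul_monomial, smul_eq_mul, mul_one]
      rw [h1, map_smul, coeff_smul, coeff_smul, toricHom_xpow, coeff_xpow, coeff_xpow]
      congr 1
      by_cases h : (u : Fin n → ℕ) = v
      · simp [h]
      · rw [if_neg h, if_neg (mt (hv u) h)]
    | add p q hp hq => rw [map_add, coeff_add, coeff_add, hp, hq]
  rw [← key, mem_toricIdeal.1 hg, coeff_zero]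

/-- If a binomial is in an ideal generated by binomials, then its exponent difference is in every
group containing the exponent differences of the generators. -/
theorem sub_mem_of_xpow_sub_mem {ι : Type*} {p q : ι → Fin n → ℕ} {K : AddSubgroup (Fin n → ℤ)}
    (hK : ∀ i, (fun j => (p i j : ℤ) - q i j) ∈ K) {u v : Fin n → ℕ}
    (h : xpow k u - xpow k v ∈ Ideal.span (Set.range fun i => xpow k (p i) - xpow k (q i))) :
    (fun j => (u j : ℤ) - v j) ∈ K := by
  -- pass to the algebra of the quotient group
  let ψ : MvPolynomial (Fin n) k →ₐ[k] AddMonoidAlgebra k ((Fin n → ℤ) ⧸ K) :=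
    aeval (fun i => AddMonoidAlgebra.single (QuotientAddGroup.mk (Pi.single i 1)) 1)
  have hψ : ∀ u : Fin n → ℕ, ψ (xpow k u) =
      AddMonoidAlgebra.single (QuotientAddGroup.mk (fun j => (u j : ℤ))) 1 := by
    intro u
    have h1 : ∀ (s : Finset (Fin n)) (b : Fin n → ((Fin n → ℤ) ⧸ K)),
        ∏ i ∈ s, AddMonoidAlgebra.single (b i) (1 : k) =
          AddMonoidAlgebra.single (∑ i ∈ s, b i) 1 := by
      classical
      intro s b
      induction s using Finset.induction_on with
      | empty => simp [AddMonoidAlgebra.one_def]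
      | insert i s hi ih =>
        rw [Finset.prod_insert hi, Finset.sum_insert hi, ih, AddMonoidAlgebra.single_mul_single,
          one_mul]
    simp only [ψ, xpow, map_prod, map_pow, aeval_X, AddMonoidAlgebra.single_pow, one_pow]
    rw [h1]
    congr 1
    have h2 : (fun j => (u j : ℤ)) = ∑ i, u i • (Pi.single i 1 : Fin n → ℤ) := by
      ext j
      simp [Finset.sum_apply, Pi.single_apply]
    rw [h2]
    exact (map_sum (QuotientAddGroup.mk' K) _ _).symm
  have hker : Ideal.span (Set.range fun i => xpow k (p i) - xpow k (q i)) ≤ RingHom.ker ψ := by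
    rw [Ideal.span_le]
    rintro _ ⟨i, rfl⟩
    rw [SetLike.mem_coe, RingHom.mem_ker, map_sub, hψ, hψ, sub_eq_zero]
    congr 1
    rw [eq_comm, QuotientAddGroup.eq]
    convert hK i using 1
    ext j
    simp
    ring
  have h3 := hker h
  rw [RingHom.mem_ker, map_sub, hψ, hψ, sub_eq_zero,
    AddMonoidAlgebra.single_left_inj one_ne_zero, eq_comm, QuotientAddGroup.eq] at h3
  convert h3 using 1
  ext j
  simp
  ring

/-! ### Critical binomials -/

/-- The binomial `x_i ^ m_i - x ^ β`. -/
noncomputable def critBinomial (k : Type*) [Field k] {n m : ℕ} (a : Fin n → Fin m → ℕ)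
    (i : Fin n) (β : Fin n → ℕ) : MvPolynomial (Fin n) k :=
  xpow k (Pi.single i (critExp a i)) - xpow k β

theorem inConeOfOthers_of_critExp_ne_zero {a : Fin n → Fin m → ℕ} {i : Fin n}
    (h : critExp a i ≠ 0) : InConeOfOthers a i := by
  obtain ⟨β, h1, h2⟩ := exists_wt_eq_critExp h
  have h3 : (fun l => (a i l : ℝ)) =
      ∑ j, ((critExp a i : ℝ)⁻¹ * β j) • (fun l => (a j l : ℝ)) := by
    ext l
    have h4 : (∑ j, (β j : ℝ) * a j l) = critExp a i * a i l := by
      have := congrFun h2 l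
      rw [wt_apply] at this
      exact_mod_cast this
    have h5 : (critExp a i : ℝ) ≠ 0 := by exact_mod_cast h
    simp only [Finset.sum_apply, Pi.smul_apply, smul_eq_mul, mul_assoc, ← Finset.mul_sum, h4]
    field_simp
  rw [InConeOfOthers, h3]
  refine sum_mem fun j _ => ?_
  by_cases hj : j = i
  · subst hj
    simp [h1]
  · have h0 : (0 : ℝ) ≤ (critExp a i : ℝ)⁻¹ * β j := by positivity
    exact PointedCone.smul_mem _ h0
      (Submodule.subset_span ⟨a j, ⟨j, hj, rfl⟩, rfl⟩)

theorem IsCriticalBinomial.exists_eq {a : Fin n → Fin m → ℕ} {i : Fin n}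
    {f : MvPolynomial (Fin n) k} (h : IsCriticalBinomial k a i f) :
    ∃ β : Fin n → ℕ, β i = 0 ∧ wt a β = critExp a i • a i ∧ f = critBinomial k a i β := by
  obtain ⟨-, ⟨β, rfl⟩, hf⟩ := h
  have h1 : X i ^ critExp a i - ∏ j ∈ Finset.univ.erase i, X j ^ β j =
      critBinomial k a i (Function.update β i 0) := by
    rw [critBinomial, xpow_single, xpow, ← Finset.mul_prod_erase _ _ (Finset.mem_univ i)]
    simp only [Function.update_self, pow_zero, one_mul]
    congr 1
    refine Finset.prod_congr rfl fun j hj => ?_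
    rw [Function.update_of_ne (Finset.ne_of_mem_erase hj)]
  rw [h1] at hf ⊢
  refine ⟨_, by simp, ?_, rfl⟩
  rw [← sub_mem_toricIdeal_iff.1 hf, wt_single]

theorem isCriticalBinomial_critBinomial {a : Fin n → Fin m → ℕ} {i : Fin n} {β : Fin n → ℕ}
    (hm : critExp a i ≠ 0) (h0 : β i = 0) (h : wt a β = critExp a i • a i) :
    IsCriticalBinomial k a i (critBinomial k a i β) := by
  refine ⟨inConeOfOthers_of_critExp_ne_zero hm, ⟨β, ?_⟩, ?_⟩
  · rw [critBinomial, xpow_single, xpow, ← Finset.mul_prod_erase _ _ (Finset.mem_univ i), h0,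
      pow_zero, one_mul]
  · rw [critBinomial, sub_mem_toricIdeal_iff, wt_single, h]

/-- The congruence on exponent vectors defined by an ideal: two monomials are congruent. -/
def idealCon (J : Ideal (MvPolynomial (Fin n) k)) : AddCon (Fin n → ℕ) where
  r u v := xpow k u - xpow k v ∈ J
  iseqv :=
    { refl := fun u => by simp
      symm := fun h => by simpa using J.neg_mem h
      trans := fun h h' => by simpa using J.add_mem h h' }
  add' {u v w z} h h' := by
    rw [xpow_add, xpow_add]
    have : xpow k u * xpow k w - xpow k v * xpow k z =
        (xpow k u - xpow k v) * xpow k w + xpow k v * (xpow k w - xpow k z) := by ring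
    rw [this]
    exact J.add_mem (J.mul_mem_right _ h) (J.mul_mem_left _ h')

/-! ### The height of a simplicial toric ideal -/

/-- A positive multiple of each `a i` is a combination of the axis vectors. -/
theorem IsSimplicial.exists_axis_relation {a : Fin n → Fin m → ℕ} (ha : IsSimplicial a)
    (i : Fin n) : ∃ (D : ℕ) (β : Fin n → ℕ), D ≠ 0 ∧ (∀ j : Fin n, m ≤ (j : ℕ) → β j = 0) ∧
      wt a β = D • a i := by
  obtain ⟨d, hd, hax⟩ := ha.axis
  refine ⟨∏ l, d l, ∑ l : Fin m, Pi.single (Fin.castLE ha.lt.le l)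
    ((∏ l' ∈ Finset.univ.erase l, d l') * a i l), ?_, fun j hj => ?_, ?_⟩
  · exact Finset.prod_ne_zero_iff.2 fun l _ => (hd l).ne'
  · rw [Finset.sum_apply]
    refine Finset.sum_eq_zero fun l _ => Pi.single_eq_of_ne ?_ _
    rintro rfl
    exact absurd l.2 (not_lt.2 (by simpa using hj))
  · rw [map_sum]
    ext l
    simp only [wt_single, hax, Finset.sum_apply, Pi.smul_apply, smul_eq_mul]
    rw [Finset.sum_eq_single l]
    · rw [Pi.single_eq_same, ← Finset.mul_prod_erase _ _ (Finset.mem_univ l)]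
      ring
    · intro l' _ h
      rw [Pi.single_eq_of_ne (Ne.symm h), mul_zero]
    · simp

theorem IsSimplicial.critExp_ne_zero {a : Fin n → Fin m → ℕ} (ha : IsSimplicial a) {i : Fin n}
    (hi : m ≤ (i : ℕ)) : critExp a i ≠ 0 := by
  obtain ⟨D, β, h1, h2, h3⟩ := ha.exists_axis_relation i
  exact (critExp_le h1 (h2 i hi) h3).1

/-- The family in which the vectors `a i` with `i ≥ s` are replaced by new basis vectors. The
toric ideals of these families form a chain of primes below the toric ideal of `a`. -/
def freeFrom (a : Fin n → Fin m → ℕ) (s : ℕ) (i : Fin n) : Fin (m + n) → ℕ :=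
  Fin.append (if (i : ℕ) < s then a i else 0) (if (i : ℕ) < s then 0 else Pi.single i 1)

theorem wt_freeFrom_eq_iff {a : Fin n → Fin m → ℕ} {s : ℕ} {u v : Fin n → ℕ} :
    wt (freeFrom a s) u = wt (freeFrom a s) v ↔
      (∀ i : Fin n, s ≤ (i : ℕ) → u i = v i) ∧ wt a u = wt a v := by
  have h1 : ∀ (u : Fin n → ℕ) (i : Fin n), wt (freeFrom a s) u (Fin.natAdd m i) =
      if (i : ℕ) < s then 0 else u i := by
    intro u i
    rw [wt_apply, Finset.sum_eq_single i]
    · simp only [freeFrom, Fin.append_right]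
      split_ifs <;> simp
    · intro j _ hj
      simp only [freeFrom, Fin.append_right]
      split_ifs
      · simp
      · simp [Pi.single_eq_of_ne hj.symm]
    · simp
  have h2 : ∀ (u : Fin n → ℕ) (l : Fin m), wt a u l = wt (freeFrom a s) u (Fin.castAdd n l) +
      ∑ i : Fin n, if (i : ℕ) < s then 0 else u i * a i l := by
    intro u l
    rw [wt_apply, wt_apply, ← Finset.sum_add_distrib]
    refine Finset.sum_congr rfl fun i _ => ?_
    simp only [freeFrom, Fin.append_left]
    split_ifs <;> simp
  constructor
  · intro h
    have h3 : ∀ i : Fin n, s ≤ (i : ℕ) → u i = v i := by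
      intro i hi
      have := congrFun h (Fin.natAdd m i)
      rwa [h1, h1, if_neg (by omega), if_neg (by omega)] at this
    refine ⟨h3, funext fun l => ?_⟩
    rw [h2, h2, h]
    congr 1
    refine Finset.sum_congr rfl fun i _ => ?_
    split_ifs with hi
    · rfl
    · rw [h3 i (by omega)]
  · rintro ⟨h3, h4⟩
    ext l
    refine Fin.addCases (fun l => ?_) (fun i => ?_) l
    · have h5 := congrFun h4 l
      rw [h2, h2] at h5
      have h6 : (∑ i : Fin n, if (i : ℕ) < s then 0 else u i * a i l) =
          ∑ i : Fin n, if (i : ℕ) < s then 0 else v i * a i l := by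
        refine Finset.sum_congr rfl fun i _ => ?_
        split_ifs with hi
        · rfl
        · rw [h3 i (by omega)]
      omega
    · rw [h1, h1]
      split_ifs with hi
      · rfl
      · rw [h3 i (by omega)]

theorem le_height_freeFrom {a : Fin n → Fin m → ℕ} (ha : IsSimplicial a) (s : ℕ)
    (hs : m + s ≤ n) : (s : ℕ∞) ≤ (toricIdeal k (freeFrom a (m + s))).height := by
  induction s with
  | zero => simp
  | succ s ih =>
    have hp := toricIdeal_isPrime (k := k) (freeFrom a (m + s))
    have hp' := toricIdeal_isPrime (k := k) (freeFrom a (m + (s + 1)))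
    refine le_trans ?_ (Ideal.height_add_one_le_of_lt_of_isPrime
      (I := toricIdeal k (freeFrom a (m + s))) (lt_of_le_of_ne ?_ ?_))
    · push_cast
      gcongr
      exact ih (by omega)
    · refine toricIdeal_le fun u v huv => ?_
      rw [wt_freeFrom_eq_iff] at huv
      rw [sub_mem_toricIdeal_iff, wt_freeFrom_eq_iff]
      exact ⟨fun i hi => huv.1 i (by omega), huv.2⟩
    · intro heq
      let i : Fin n := ⟨m + s, by omega⟩
      obtain ⟨D, β, h1, h2, h3⟩ := ha.exists_axis_relation i
      have h4 : xpow k (Pi.single i D) - xpow k β ∈ toricIdeal k (freeFrom a (m + (s + 1))) := by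
        rw [sub_mem_toricIdeal_iff, wt_freeFrom_eq_iff]
        refine ⟨fun j hj => ?_, by rw [wt_single, h3]⟩
        rw [h2 j (by omega), Pi.single_eq_of_ne]
        intro hji
        have : (j : ℕ) = m + s := congrArg Fin.val hji
        omega
      rw [← heq, sub_mem_toricIdeal_iff, wt_freeFrom_eq_iff] at h4
      have h5 := h4.1 i le_rfl
      rw [h2 i (Nat.le_add_right m s), Pi.single_eq_same] at h5
      exact h1 h5

theorem le_height_toricIdeal {a : Fin n → Fin m → ℕ} (ha : IsSimplicial a) :
    ((n - m : ℕ) : ℕ∞) ≤ (toricIdeal k a).height := by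
  have hlt := ha.lt
  refine (le_height_freeFrom (k := k) ha (n - m) (by omega)).trans (Ideal.height_mono ?_)
  refine toricIdeal_le fun u v huv => ?_
  rw [wt_freeFrom_eq_iff] at huv
  exact sub_mem_toricIdeal_iff.2 huv.2

/-- The toric homomorphism followed by setting the first `s` variables to `0`; the kernels form a
chain of primes above the toric ideal. -/
noncomputable def faceHom (k : Type*) [Field k] {n m : ℕ} (a : Fin n → Fin m → ℕ) (s : ℕ) :
    MvPolynomial (Fin n) k →ₐ[k] MvPolynomial (Fin m) k :=
  (aeval (fun l : Fin m => if (l : ℕ) < s then 0 else (X l : MvPolynomial (Fin m) k))).comp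
    (toricHom k a)

theorem height_add_le_height_ker_faceHom {a : Fin n → Fin m → ℕ} (ha : IsSimplicial a) (s : ℕ)
    (hs : s ≤ m) : (toricIdeal k a).height + s ≤ (RingHom.ker (faceHom k a s)).height := by
  induction s with
  | zero =>
    simp only [Nat.cast_zero, add_zero]
    refine Ideal.height_mono fun f hf => ?_
    rw [RingHom.mem_ker, faceHom, AlgHom.comp_apply, mem_toricIdeal.1 hf, map_zero]
  | succ s ih =>
    have hp : (RingHom.ker (faceHom k a s)).IsPrime := RingHom.ker_isPrime _
    have hp' : (RingHom.ker (faceHom k a (s + 1))).IsPrime := RingHom.ker_isPrime _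
    refine le_trans ?_ (Ideal.height_add_one_le_of_lt_of_isPrime
      (I := RingHom.ker (faceHom k a s)) (lt_of_le_of_ne ?_ ?_))
    · push_cast
      rw [← add_assoc]
      gcongr
      exact ih (by omega)
    · have hcomp : faceHom k a (s + 1) = (aeval (fun l : Fin m => if (l : ℕ) < s + 1 then 0 else
          (X l : MvPolynomial (Fin m) k))).comp (faceHom k a s) := by
        rw [faceHom, faceHom, ← AlgHom.comp_assoc]
        congr 1
        ext1 l
        simp only [AlgHom.comp_apply, aeval_X]
        by_cases h1 : (l : ℕ) < s
        · rw [if_pos h1, if_pos (by omega), map_zero]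
        · rw [if_neg h1, aeval_X]
      intro f hf
      rw [RingHom.mem_ker] at hf ⊢
      rw [hcomp, AlgHom.comp_apply, hf, map_zero]
    · intro heq
      obtain ⟨d, hd, hax⟩ := ha.axis
      let l : Fin m := ⟨s, by omega⟩
      have h1 : ∀ t, faceHom k a t (X (Fin.castLE ha.lt.le l)) =
          (if (l : ℕ) < t then 0 else X l) ^ d l := by
        intro t
        rw [faceHom, AlgHom.comp_apply, toricHom, aeval_X, hax, xpow_single, map_pow, aeval_X]
      have h2 : X (Fin.castLE ha.lt.le l) ∈ RingHom.ker (faceHom k a (s + 1)) := by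
        rw [RingHom.mem_ker, h1, if_pos (Nat.lt_succ_self s), zero_pow (hd l).ne']
      rw [← heq, RingHom.mem_ker, h1, if_neg (lt_irrefl s)] at h2
      exact pow_ne_zero _ (X_ne_zero l) h2

theorem height_toricIdeal {a : Fin n → Fin m → ℕ} (ha : IsSimplicial a) :
    (toricIdeal k a).height = ((n - m : ℕ) : ℕ∞) := by
  refine le_antisymm ?_ (le_height_toricIdeal ha)
  have h1 := height_add_le_height_ker_faceHom (k := k) ha m le_rfl
  have hp : (RingHom.ker (faceHom k a m)).IsPrime := RingHom.ker_isPrime _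
  have h2 := Ideal.height_le_ringKrullDim_of_ne_top hp.ne_top
  rw [MvPolynomial.ringKrullDim_of_isNoetherianRing, ringKrullDim_eq_zero_of_field, zero_add,
    Nat.card_fin] at h2
  have h3 : (RingHom.ker (faceHom k a m)).height ≤ (n : ℕ∞) := by exact_mod_cast h2
  have h4 := h1.trans h3
  have hlt := ha.lt
  obtain ⟨h, hh⟩ := ENat.ne_top_iff_exists.1
    (ne_top_of_le_ne_top (ENat.natCast_ne_top n) (le_self_add.trans h4))
  rw [← hh] at h4 ⊢
  norm_cast at h4 ⊢
  omega

/-! ### Empty output implies generation by critical binomials -/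

/-- If all vectors can be removed, the relations of the state `c` are generated by any critical
relations expressed in the vectors of `c`. -/
theorem Reach.congruence_of_zero {a : Fin n → Fin m → ℕ} (hz : ∀ i, a i ≠ 0) (H : CritDistinct a)
    {c : Fin n → ℕ} (h : Reach a c 0) (r : AddCon (Fin n → ℕ)) (hc : GoodState a c)
    (hr : ∀ j, c j ≠ 0 → critExp a j ≠ 0 → ∃ β : Fin n → ℕ, β j = 0 ∧
      (∀ l, c l ∣ β l) ∧ wt a β = critExp a j • a j ∧ r (Pi.single j (critExp a j)) β) :
    ∀ u v : Fin n → ℕ, (∀ j, c j ∣ u j) → (∀ j, c j ∣ v j) → wt a u = wt a v → r u v := by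
  induction h using Relation.ReflTransGen.head_induction_on with
  | refl =>
    intro u v hu hv _
    have : u = v := by
      ext j
      rw [zero_dvd_iff.1 (hu j), zero_dvd_iff.1 (hv j)]
    rw [this]
    exact r.refl v
  | @head c e h _ ih =>
    obtain ⟨i, hi, rfl⟩ := h
    have IH := ih (hc.step hz H hi) (hc.exists_crit_step hz H hi hr)
    have main : ∀ u v : Fin n → ℕ, (∀ j, c j ∣ u j) → (∀ j, c j ∣ v j) → wt a u = wt a v →
        v i ≤ u i → r u v := by
      intro u v hu hv huv hle
      have hb := stepVal_dvd_of_wt_eq hc.inj hi hu hv huv hle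
      have hsplit : ∀ w : Fin n → ℕ, v i ≤ w i →
          w = Pi.single i (v i) + Function.update w i (w i - v i) := by
        intro w hw
        ext l
        by_cases hl : l = i
        · subst hl; simp [Nat.add_sub_cancel' hw]
        · simp [hl]
      set u' := Function.update u i (u i - v i) with hu'
      set v' := Function.update v i (v i - v i) with hv'
      have huv' : wt a u' = wt a v' := by
        have e1 := congrArg (wt a) (hsplit u hle)
        have e2 := congrArg (wt a) (hsplit v le_rfl)
        rw [map_add] at e1 e2
        exact add_left_cancel (e1.symm.trans (huv.trans e2))
      have hv'mem : ∀ j, step a c i j ∣ v' j := by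
        intro j
        by_cases hj : j = i
        · subst hj; simp [hv']
        · rw [step_of_ne hj]
          simpa [hv', hj] using hv j
      suffices hs : r u' v' by
        have := r.add (r.refl (Pi.single i (v i))) hs
        rwa [hu', hv', ← hsplit u hle, ← hsplit v le_rfl] at this
      by_cases hrem : critExp a i ∣ stepVal a c i ∧ critExp a i ≠ 0
      · obtain ⟨hd, hm0⟩ := hrem
        rw [← hc.critExp_eq_stepVal hi hd] at hb
        obtain ⟨q, hq⟩ := hb
        obtain ⟨β, h1, h2, h3, h4⟩ := hr i hi hm0
        have hq' : u' i = critExp a i * q := by simp [hu', hq]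
        refine r.trans (rel_update_add_smul h4 hq') (IH _ _ (fun j => ?_) hv'mem ?_)
        · by_cases hj : j = i
          · subst hj; simp [h1]
          · rw [step_of_ne hj]
            simpa [hu', hj] using dvd_add (hu j) (Dvd.dvd.mul_left (h2 j) q)
        · rw [wt_update_add_smul h3 hq', huv']
      · refine IH _ _ (fun j => ?_) hv'mem huv'
        by_cases hj : j = i
        · subst hj
          by_cases hd : critExp a j ∣ stepVal a c j
          · have hm0 : critExp a j = 0 := by
              by_contra hm
              exact hrem ⟨hd, hm⟩
            rw [← hc.critExp_eq_stepVal hi hd, hm0] at hb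
            simp [hu', zero_dvd_iff.1 hb]
          · simpa [hu', step, hd] using hb
        · rw [step_of_ne hj]
          simpa [hu', hj] using hu j
    intro u v hu hv huv
    rcases le_total (v i) (u i) with hle | hle
    · exact main u v hu hv huv hle
    · exact r.symm (main v u hv hu huv.symm hle)

/-- The vector `a j` lies on the `l`-th coordinate axis. -/
def OnAxis (a : Fin n → Fin m → ℕ) (l : Fin m) (j : Fin n) : Prop :=
  ∀ l', l' ≠ l → a j l' = 0

theorem OnAxis.of_wt_eq {a : Fin n → Fin m → ℕ} {l : Fin m} {j : Fin n} (hj : OnAxis a l j)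
    {b : ℕ} {β : Fin n → ℕ} (h : wt a β = b • a j) {p : Fin n} (hp : β p ≠ 0) :
    OnAxis a l p := by
  intro l' hl'
  have h1 := congrFun h l'
  rw [wt_apply, Pi.smul_apply, hj l' hl', smul_zero, Finset.sum_eq_zero_iff] at h1
  exact (mul_eq_zero.1 (h1 p (Finset.mem_univ p))).resolve_left hp

/-- When only two vectors of a state lie on an axis, neither of them is removed by a step: both
critical relations would be between these two vectors only, hence equal. -/
theorem step_self_ne_zero_of_axis {a : Fin n → Fin m → ℕ} (hz : ∀ i, a i ≠ 0)
    (H : CritDistinct a) {c : Fin n → ℕ} (hc : GoodState a c) {l : Fin m} {j p : Fin n}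
    (hjp : j ≠ p) (hj : c j ≠ 0) (hp : c p ≠ 0) (haj : OnAxis a l j) (hap : OnAxis a l p)
    (honly : ∀ q, c q ≠ 0 → OnAxis a l q → q = j ∨ q = p) : step a c j j ≠ 0 := by
  have hpos : ∀ {q}, OnAxis a l q → a q l ≠ 0 := by
    intro q hq h0
    refine hz q (funext fun l' => ?_)
    by_cases hl : l' = l
    · rw [hl, h0]; rfl
    · exact hq l' hl
  have hext : ∀ {q q' : Fin n} {x y : ℕ}, OnAxis a l q → OnAxis a l q' → x * a q l = y * a q' l →
      x • a q = y • a q' := by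
    intro q q' x y hq hq' h
    ext l'
    by_cases hl : l' = l
    · rw [hl]; simpa using h
    · simp [hq l' hl, hq' l' hl]
  have hval : stepVal a c j ≠ 0 := by
    have h1 : stepVal a c j ∣ c j * c p * a p l := by
      have h2 := stepVal_dvd_of_wt_eq hc.inj hj (u := Pi.single j (c j * c p * a p l))
        (v := Pi.single p (c j * c p * a j l)) (fun q => ?_) (fun q => ?_) ?_ (by simp [hjp])
      · simpa [hjp] using h2
      · by_cases hq : q = j
        · subst hq; simp [mul_assoc]
        · simp [hq]
      · by_cases hq : q = p
        · subst hq; simp [mul_comm (c j), mul_assoc]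
        · simp [hq]
      · rw [wt_single, wt_single]
        exact hext haj hap (by ring)
    intro h0
    rw [h0, zero_dvd_iff] at h1
    simp [hj, hp, hpos hap] at h1
  intro h0
  have hd : critExp a j ∣ stepVal a c j := by
    by_contra hd
    simp only [step, hd, if_false, Function.update_self] at h0
    exact hval h0
  have hmj : critExp a j ≠ 0 := by
    rw [hc.critExp_eq_stepVal hj hd]
    exact hval
  -- a critical relation of one of the two vectors is a multiple of the other one
  have hrel : ∀ {q q' : Fin n}, c q ≠ 0 → OnAxis a l q → critExp a q ≠ 0 →
      (∀ p, c p ≠ 0 → OnAxis a l p → p = q ∨ p = q') →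
      ∃ b : ℕ, b • a q' = critExp a q • a q := by
    intro q q' hq haq hm hon
    obtain ⟨β, h1, h2, h3⟩ := hc.crit q hq hm
    refine ⟨β q', ?_⟩
    rw [← h3, ← wt_single]
    congr 1
    ext p
    by_cases hp : p = q'
    · subst hp; simp
    · rw [Pi.single_eq_of_ne hp]
      by_contra hne
      have hcp : c p ≠ 0 := by
        intro h0
        have := h2 p
        rw [h0, zero_dvd_iff] at this
        exact hne this.symm
      rcases hon p hcp (haq.of_wt_eq h3 (Ne.symm hne)) with rfl | rfl
      · exact hne h1.symm
      · exact hp rfl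
  obtain ⟨b, hb⟩ := hrel hj haj hmj honly
  have hb0 : b ≠ 0 := by
    rintro rfl
    have := congrFun hb l
    simp [hmj, hpos haj] at this
  obtain ⟨hmp, hmpb⟩ := critExp_le (a := a) (i := p) (β := Pi.single j (critExp a j)) hb0
    (by simp [hjp.symm]) (by rw [wt_single, hb])
  obtain ⟨b', hb'⟩ := hrel hp hap hmp (fun q h1 h2 => (honly q h1 h2).symm)
  have hb0' : b' ≠ 0 := by
    rintro rfl
    have := congrFun hb' l
    simp [hmp, hpos hap] at this
  obtain ⟨-, hmjb⟩ := critExp_le (a := a) (i := j) (β := Pi.single p (critExp a p)) hb0'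
    (by simp [hjp]) (by rw [wt_single, hb'])
  refine H j p hjp hmj hmp (hext haj hap ?_)
  have e1 : b * a p l = critExp a j * a j l := by simpa using congrFun hb l
  have e2 : b' * a j l = critExp a p * a p l := by simpa using congrFun hb' l
  have i1 : critExp a p * a p l ≤ b * a p l := Nat.mul_le_mul_right _ hmpb
  have i2 : critExp a j * a j l ≤ b' * a j l := Nat.mul_le_mul_right _ hmjb
  omega

/-- Two different vectors of the state `c` lie on the `l`-th axis. -/
def TwoOnAxis (a : Fin n → Fin m → ℕ) (l : Fin m) (c : Fin n → ℕ) : Prop :=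
  ∃ j p, j ≠ p ∧ c j ≠ 0 ∧ c p ≠ 0 ∧ OnAxis a l j ∧ OnAxis a l p

theorem TwoOnAxis.step {a : Fin n → Fin m → ℕ} (hz : ∀ i, a i ≠ 0)
    (H : CritDistinct a) {c : Fin n → ℕ} (hc : GoodState a c) {l : Fin m} {i : Fin n}
    (h : TwoOnAxis a l c) : TwoOnAxis a l (step a c i) := by
  have key : ∀ j p, j ≠ p → c j ≠ 0 → c p ≠ 0 → OnAxis a l j → OnAxis a l p → i ≠ p →
      TwoOnAxis a l (SimplicialToric.step a c i) := by
    intro j p hjp hj hp haj hap hip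
    have hp' : SimplicialToric.step a c i p ≠ 0 := by rwa [step_of_ne (Ne.symm hip)]
    by_cases hij : j = i
    · subst hij
      by_cases honly : ∀ q, c q ≠ 0 → OnAxis a l q → q = j ∨ q = p
      · exact ⟨j, p, hjp, step_self_ne_zero_of_axis hz H hc hjp hj hp haj hap honly, hp', haj, hap⟩
      · push Not at honly
        obtain ⟨q, h1, h2, h3, h4⟩ := honly
        exact ⟨q, p, h4, by rwa [step_of_ne h3], hp', h2, hap⟩
    · exact ⟨j, p, hjp, by rwa [step_of_ne hij], hp', haj, hap⟩
  obtain ⟨j, p, hjp, hj, hp, haj, hap⟩ := h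
  by_cases hip : i = p
  · exact key p j hjp.symm hp hj hap haj (fun h => hjp (h.symm.trans hip))
  · exact key j p hjp hj hp haj hap hip

/-- If all vectors can be removed, no other vector lies on the axis of `a i` for `i < m`. -/
theorem IsSimplicial.critExp_eq_zero_of_reach {a : Fin n → Fin m → ℕ} (ha : IsSimplicial a)
    (H : CritDistinct a) (h : Reach a (fun _ => 1) 0) {i : Fin n} (hi : (i : ℕ) < m) :
    critExp a i = 0 := by
  by_contra hm
  obtain ⟨β, h1, h2⟩ := exists_wt_eq_critExp hm
  obtain ⟨d, hd, hax⟩ := ha.axis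
  have hai : OnAxis a ⟨i, hi⟩ i := by
    intro l hl
    have := hax ⟨i, hi⟩
    rw [show Fin.castLE ha.lt.le ⟨i, hi⟩ = i from rfl] at this
    rw [this, Pi.single_eq_of_ne hl]
  have hβ : β ≠ 0 := by
    rintro rfl
    rw [map_zero, eq_comm, ← wt_single] at h2
    exact hm (by simpa using congrFun (wt_eq_zero ha.ne_zero h2) i)
  obtain ⟨p, hp⟩ := Function.ne_iff.1 hβ
  have htwo : TwoOnAxis a ⟨i, hi⟩ (fun _ => 1) := by
    refine ⟨i, p, ?_, one_ne_zero, one_ne_zero, hai, hai.of_wt_eq h2 hp⟩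
    rintro rfl
    exact hp h1
  have key : ∀ c, Reach a (fun _ => 1) c → TwoOnAxis a ⟨i, hi⟩ c := by
    intro c hc
    induction hc with
    | refl => exact htwo
    | tail h1 h2 ih =>
      obtain ⟨j, -, rfl⟩ := h2
      exact ih.step ha.ne_zero H (Reach.good ha.ne_zero H h1 (goodState_one ha.injective))
  obtain ⟨j, -, -, hj, -⟩ := key 0 h
  exact hj rfl

/-- If the algorithm can remove all vectors, an ideal containing one critical binomial for each
`i ≥ m` contains the toric ideal. -/
theorem IsSimplicial.toricIdeal_le_of_reach {k : Type*} [Field k] {a : Fin n → Fin m → ℕ}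
    (ha : IsSimplicial a) (H : CritDistinct a) (h : Reach a (fun _ => 1) 0)
    {J : Ideal (MvPolynomial (Fin n) k)}
    (hJ : ∀ i : Fin n, m ≤ (i : ℕ) → ∃ f ∈ J, IsCriticalBinomial k a i f) :
    toricIdeal k a ≤ J := by
  refine toricIdeal_le fun u v huv => h.congruence_of_zero ha.ne_zero H (idealCon J)
    (goodState_one ha.injective) (fun i _ hm => ?_) u v (fun _ => one_dvd _) (fun _ => one_dvd _)
    huv
  have hi : m ≤ (i : ℕ) := by
    by_contra hlt
    exact hm (ha.critExp_eq_zero_of_reach H h (not_le.1 hlt))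
  obtain ⟨f, hf, hcrit⟩ := hJ i hi
  obtain ⟨β, h1, h2, rfl⟩ := hcrit.exists_eq
  exact ⟨β, h1, fun _ => one_dvd _, h2, hf⟩

/-! ### Complete intersections are generated by critical binomials -/

theorem card_nonaxis (hmn : m ≤ n) : Fintype.card {i : Fin n // m ≤ (i : ℕ)} = n - m := by
  have h := Fintype.card_subtype_compl (fun i : Fin n => (i : ℕ) < m)
  have h2 : Fintype.card {i : Fin n // (i : ℕ) < m} = m := by
    refine (Fintype.card_congr (β := Fin m) ⟨fun i => ⟨i.1, i.2⟩,
      fun i => ⟨⟨i, by omega⟩, i.2⟩, fun _ => rfl, fun _ => rfl⟩).trans (Fintype.card_fin m)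
  rw [h2, Fintype.card_fin] at h
  rw [← h]
  exact Fintype.card_congr (Equiv.subtypeEquivRight fun i => not_lt.symm)

/-- The coefficient functional at `x_i ^ m_i` kills `𝔪 I`, for `I` the toric ideal and `𝔪` the
ideal of polynomials without constant term. -/
theorem coeff_critExp_mul {a : Fin n → Fin m → ℕ} (hz : ∀ i, a i ≠ 0) {i : Fin n}
    (hm : critExp a i ≠ 0) {g : MvPolynomial (Fin n) k} (hg : g ∈ toricIdeal k a)
    (p : MvPolynomial (Fin n) k) :
    coeff (Finsupp.equivFunOnFinite.symm (Pi.single i (critExp a i))) (p * g) =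
      constantCoeff p *
        coeff (Finsupp.equivFunOnFinite.symm (Pi.single i (critExp a i))) g := by
  induction p using MvPolynomial.induction_on with
  | C c => rw [coeff_C_mul, constantCoeff_C]
  | add p q hp hq => rw [add_mul, coeff_add, hp, hq, map_add, add_mul]
  | mul_X p l _ =>
    rw [map_mul, constantCoeff_X, mul_zero, zero_mul, mul_right_comm, coeff_mul_X']
    split_ifs with hl
    · have hl' : l = i := by
        by_contra hne
        exact Finsupp.mem_support_iff.1 hl (Pi.single_eq_of_ne hne _)
      subst hl'
      have heq : Finsupp.equivFunOnFinite.symm (Pi.single l (critExp a l)) - Finsupp.single l 1 =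
          Finsupp.equivFunOnFinite.symm (Pi.single l (critExp a l - 1)) := by
        ext j
        by_cases hj : j = l
        · subst hj; simp
        · simp [hj]
      rw [heq]
      -- `x_l ^ (m_l - 1)` is alone in its degree
      refine coeff_eq_zero_of_mem_toricIdeal (fun u hu => ?_) ((toricIdeal k a).mul_mem_left p hg)
      by_contra hne
      obtain ⟨-, -, h⟩ := critExp_le_of_wt_eq hz (by rw [hu, wt_single]) hne
      omega
    · rfl

theorem coeff_critBinomial {a : Fin n → Fin m → ℕ} (H : CritDistinct a) {i j : Fin n}
    (hmi : critExp a i ≠ 0) (hmj : critExp a j ≠ 0) {β : Fin n → ℕ} (h0 : β j = 0)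
    (h : wt a β = critExp a j • a j) :
    coeff (Finsupp.equivFunOnFinite.symm (Pi.single i (critExp a i))) (critBinomial k a j β) =
      if j = i then 1 else 0 := by
  rw [critBinomial, coeff_sub, coeff_xpow, coeff_xpow]
  by_cases hji : j = i
  · subst hji
    have : β ≠ Pi.single j (critExp a j) := by
      rintro rfl
      simp [hmj] at h0
    simp [this]
  · have h1 : (Pi.single j (critExp a j) : Fin n → ℕ) ≠ Pi.single i (critExp a i) := by
      intro h2
      have := congrFun h2 j
      rw [Pi.single_eq_same, Pi.single_eq_of_ne hji] at this
      exact hmj this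
    have h2 : β ≠ Pi.single i (critExp a i) := by
      rintro rfl
      rw [wt_single] at h
      exact H i j (Ne.symm hji) hmi hmj h
    simp [h1, h2, hji]

/-- If the toric ideal has as few generators as there are critical binomials `f_i`, `i ≥ m`, then
these generate it modulo `𝔪 I`: the coefficient functionals at the `x_i ^ m_i` show that the
matrix expressing the `f_i` through the generators is invertible modulo `𝔪`. -/
theorem toricIdeal_le_sup {a : Fin n → Fin m → ℕ} (hz : ∀ i, a i ≠ 0) (H : CritDistinct a)
    (hm : ∀ i : Fin n, m ≤ (i : ℕ) → critExp a i ≠ 0) {s : Finset (MvPolynomial (Fin n) k)}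
    (hcard : s.card = Fintype.card {i : Fin n // m ≤ (i : ℕ)})
    (hs : Ideal.span (s : Set (MvPolynomial (Fin n) k)) = toricIdeal k a)
    {β : Fin n → Fin n → ℕ} (h0 : ∀ i : Fin n, m ≤ (i : ℕ) → β i i = 0)
    (hβ : ∀ i : Fin n, m ≤ (i : ℕ) → wt a (β i) = critExp a i • a i)
    {J : Ideal (MvPolynomial (Fin n) k)}
    (hJ : ∀ i : Fin n, m ≤ (i : ℕ) → critBinomial k a i (β i) ∈ J) :
    toricIdeal k a ≤ J ⊔ RingHom.ker (constantCoeff : MvPolynomial (Fin n) k →+* k) •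
      toricIdeal k a := by
  classical
  have hsI : ∀ x : s, (x : MvPolynomial (Fin n) k) ∈ toricIdeal k a := fun x =>
    hs ▸ Ideal.subset_span x.2
  have hrange : Ideal.span (Set.range (Subtype.val : s → MvPolynomial (Fin n) k)) =
      toricIdeal k a := by
    rw [← hs]
    congr 1
    ext x
    simp
  have hex : ∀ j : {i : Fin n // m ≤ (i : ℕ)}, ∃ p : s → MvPolynomial (Fin n) k,
      ∑ x, p x * (x : MvPolynomial (Fin n) k) = critBinomial k a j (β j) := by
    intro j
    rw [← Ideal.mem_span_range_iff_exists_fun, hrange, critBinomial, sub_mem_toricIdeal_iff,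
      wt_single, hβ j j.2]
  choose p hp using hex
  let P : Matrix {i : Fin n // m ≤ (i : ℕ)} s k := fun j x => constantCoeff (p j x)
  let Q : Matrix s {i : Fin n // m ≤ (i : ℕ)} k := fun x i =>
    coeff (Finsupp.equivFunOnFinite.symm (Pi.single (i : Fin n) (critExp a i)))
      (x : MvPolynomial (Fin n) k)
  have hPQ : P * Q = 1 := by
    ext j i
    rw [Matrix.mul_apply, Matrix.one_apply]
    have h1 := congrArg
      (coeff (Finsupp.equivFunOnFinite.symm (Pi.single (i : Fin n) (critExp a i)))) (hp j)
    rw [coeff_sum, coeff_critBinomial H (hm i i.2) (hm j j.2) (h0 j j.2) (hβ j j.2)] at h1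
    simp only [← Subtype.ext_iff] at h1
    rw [← h1]
    exact Finset.sum_congr rfl fun x _ => (coeff_critExp_mul hz (hm i i.2) (hsI x) _).symm
  have hQP : Q * P = 1 := (Matrix.mul_eq_one_comm_of_card_eq _ _ _ (by simp [hcard])).1 hPQ
  conv_lhs => rw [← hrange]
  rw [Ideal.span_le]
  rintro _ ⟨x, rfl⟩
  have hdec : (x : MvPolynomial (Fin n) k) = ∑ j, C (Q x j) * critBinomial k a j (β j) +
      ∑ y : s, (C (if x = y then 1 else 0) - ∑ j, C (Q x j) * p j y) *
        (y : MvPolynomial (Fin n) k) := by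
    have h1 : ∑ j, C (Q x j) * critBinomial k a j (β j) =
        ∑ y : s, (∑ j, C (Q x j) * p j y) * (y : MvPolynomial (Fin n) k) := by
      simp_rw [← hp, Finset.mul_sum, Finset.sum_mul]
      rw [Finset.sum_comm]
      simp_rw [mul_assoc]
    rw [h1, ← Finset.sum_add_distrib]
    simp_rw [← add_mul, add_sub_cancel]
    simp
  rw [SetLike.mem_coe, hdec]
  refine Submodule.add_mem_sup (J.sum_mem fun j _ => J.mul_mem_left _ (hJ j j.2)) ?_
  refine Submodule.sum_mem _ fun y _ => Submodule.smul_mem_smul ?_ (hsI y)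
  have h2 := congrFun (congrFun hQP x) y
  rw [Matrix.mul_apply, Matrix.one_apply] at h2
  rw [RingHom.mem_ker, map_sub, map_sum, constantCoeff_C, ← h2, sub_eq_zero]
  simp [P]

theorem weight_eq_wt (a : Fin n → Fin m → ℕ) (u : Fin n →₀ ℕ) :
    Finsupp.weight a u = wt a u := by
  rw [Finsupp.weight_apply, Finsupp.sum_fintype _ _ (by simp), wt_def]

theorem isWeightedHomogeneous_xpow (a : Fin n → Fin m → ℕ) (u : Fin n → ℕ) :
    IsWeightedHomogeneous a (xpow k u) (wt a u) := by
  rw [xpow_eq_monomial]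
  exact isWeightedHomogeneous_monomial _ _ _ (weight_eq_wt a _)

/-- The graded form of Nakayama's lemma for the toric ideal and an ideal generated by binomials
of it. -/
theorem toricIdeal_le_of_le_sup {a : Fin n → Fin m → ℕ} (hz : ∀ i, a i ≠ 0) {ι : Type*}
    {p q : ι → Fin n → ℕ} (hpq : ∀ i, wt a (p i) = wt a (q i))
    (h : toricIdeal k a ≤ Ideal.span (Set.range fun i => xpow k (p i) - xpow k (q i)) ⊔
      RingHom.ker (constantCoeff : MvPolynomial (Fin n) k →+* k) • toricIdeal k a) :
    toricIdeal k a ≤ Ideal.span (Set.range fun i => xpow k (p i) - xpow k (q i)) := by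
  classical
  obtain ⟨s, hs1, hs⟩ := Submodule.exists_sub_one_mem_and_smul_le_of_fg_of_le_sup
    ((isNoetherianRing_iff_ideal_fg _).1 inferInstance (toricIdeal k a)) le_rfl h
  let := weightedGradedAlgebra k a
  have hhom : (Ideal.span (Set.range fun i => xpow k (p i) - xpow k (q i))).IsHomogeneous
      (weightedHomogeneousSubmodule k a) := by
    refine Ideal.homogeneous_span _ _ ?_
    rintro _ ⟨i, rfl⟩
    refine ⟨wt a (p i), ?_⟩
    rw [mem_weightedHomogeneousSubmodule]
    exact (isWeightedHomogeneous_xpow a (p i)).sub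
      ((hpq i).symm ▸ isWeightedHomogeneous_xpow a (q i))
  refine toricIdeal_le fun u v huv => ?_
  set g := xpow k u - xpow k v with hg
  have hghom : IsWeightedHomogeneous a g (wt a u) :=
    (isWeightedHomogeneous_xpow a u).sub (huv ▸ isWeightedHomogeneous_xpow a v)
  -- all other terms of a multiple of `g` have larger degree
  have hcomp : ∀ t : MvPolynomial (Fin n) k,
      weightedHomogeneousComponent a (wt a u) (t * g) = constantCoeff t • g := by
    intro t
    induction t using MvPolynomial.induction_on' with
    | monomial e c =>
      have h1 : IsWeightedHomogeneous a (monomial e c * g) (wt a e + wt a u) :=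
        (isWeightedHomogeneous_monomial a e c (weight_eq_wt a e)).mul hghom
      by_cases he : e = 0
      · subst he
        have h2 : wt a ((0 : Fin n →₀ ℕ) : Fin n → ℕ) + wt a u = wt a u := by simp
        rw [h2] at h1
        rw [h1.weightedHomogeneousComponent_same, constantCoeff_monomial, if_pos rfl, smul_eq_C_mul,
          C_apply]
      · rw [h1.weightedHomogeneousComponent_ne, constantCoeff_monomial, if_neg he,
          zero_smul]
        intro h2
        have h3 : wt a (e : Fin n → ℕ) = 0 := by simpa using h2
        exact he (DFunLike.coe_injective (wt_eq_zero hz h3))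
    | add t t' h1 h2 => rw [add_mul, map_add, h1, h2, map_add, add_smul]
  have hsg : s * g ∈ Ideal.span (Set.range fun i => xpow k (p i) - xpow k (q i)) :=
    hs (Submodule.smul_mem_pointwise_smul g s _ (sub_mem_toricIdeal_iff.2 huv))
  have h1 := (hhom.mem_iff _).1 hsg (wt a u)
  rw [← DirectSum.Decomposition.decompose'_eq, weightedDecomposition.decompose'_apply,
    hcomp] at h1
  have h2 : constantCoeff s = 1 := by
    rw [RingHom.mem_ker, map_sub, map_one, sub_eq_zero] at hs1
    exact hs1
  rwa [h2, one_smul] at h1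

theorem critBinomial_image_eq {a : Fin n → Fin m → ℕ} {f : Fin n → MvPolynomial (Fin n) k}
    {β : Fin n → Fin n → ℕ} (hf : ∀ i : Fin n, m ≤ (i : ℕ) → f i = critBinomial k a i (β i)) :
    f '' {i : Fin n | m ≤ (i : ℕ)} = Set.range fun i : {i : Fin n // m ≤ (i : ℕ)} =>
      xpow k (Pi.single (i : Fin n) (critExp a i)) - xpow k (β i) := by
  ext g
  constructor
  · rintro ⟨i, hi, rfl⟩
    exact ⟨⟨i, hi⟩, (hf i hi).symm⟩
  · rintro ⟨i, rfl⟩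
    exact ⟨i, i.2, hf i i.2⟩

theorem IsSimplicial.toricIdeal_eq_of_isCompleteIntersection {a : Fin n → Fin m → ℕ}
    (ha : IsSimplicial a) (H : CritDistinct a) (h : IsCompleteIntersection (toricIdeal k a))
    {f : Fin n → MvPolynomial (Fin n) k}
    (hf : ∀ i : Fin n, m ≤ (i : ℕ) → IsCriticalBinomial k a i (f i)) :
    toricIdeal k a = Ideal.span (f '' {i : Fin n | m ≤ (i : ℕ)}) := by
  have hex : ∀ i : Fin n, ∃ β : Fin n → ℕ, m ≤ (i : ℕ) →
      β i = 0 ∧ wt a β = critExp a i • a i ∧ f i = critBinomial k a i β := by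
    intro i
    by_cases hi : m ≤ (i : ℕ)
    · obtain ⟨β, hβ⟩ := (hf i hi).exists_eq
      exact ⟨β, fun _ => hβ⟩
    · exact ⟨0, fun h => absurd h hi⟩
  choose β hβ using hex
  refine le_antisymm ?_ ?_
  · have hfg : (toricIdeal k a).FG := (isNoetherianRing_iff_ideal_fg _).1 inferInstance _
    obtain ⟨s, hs1, hs2⟩ := Submodule.FG.exists_span_finset_card_eq_spanFinrank hfg
    have hcard : s.card = Fintype.card {i : Fin n // m ≤ (i : ℕ)} := by
      rw [card_nonaxis ha.lt.le, hs1]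
      rw [IsCompleteIntersection, height_toricIdeal ha] at h
      exact_mod_cast h
    rw [critBinomial_image_eq fun i hi => (hβ i hi).2.2]
    refine toricIdeal_le_of_le_sup ha.ne_zero (fun i => ?_) (toricIdeal_le_sup ha.ne_zero H
      (fun i hi => ha.critExp_ne_zero hi) hcard hs2 (fun i hi => (hβ i hi).1)
      (fun i hi => (hβ i hi).2.1) fun i hi => Ideal.subset_span ⟨⟨i, hi⟩, rfl⟩)
    rw [wt_single, (hβ i i.2).2.1]
  · rw [Ideal.span_le]
    rintro _ ⟨i, hi, rfl⟩
    exact (hf i hi).2.2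

/-! ### Generation by critical binomials implies empty output -/

/-- If the critical binomials `f_j`, `j ≥ m`, generate the toric ideal, then no nonempty set `C`
of indices is such that each `f_j` with `j ∈ C` is in the ideal of the variables `x_i`, `i ∈ C`.
Otherwise these variables and the remaining `f_j` would be as many elements as the height of the
toric ideal, and a minimal prime over them would be larger than the toric ideal, against Krull's
height theorem. -/
theorem IsSimplicial.exists_critical_avoiding {a : Fin n → Fin m → ℕ} (ha : IsSimplicial a)
    {β : Fin n → Fin n → ℕ} (hβ : ∀ i : Fin n, m ≤ (i : ℕ) → wt a (β i) = critExp a i • a i)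
    (hI : toricIdeal k a = Ideal.span (Set.range fun i : {i : Fin n // m ≤ (i : ℕ)} =>
      xpow k (Pi.single (i : Fin n) (critExp a i)) - xpow k (β i)))
    {S : Set {i : Fin n // m ≤ (i : ℕ)}} (hS : S.Nonempty) :
    ∃ j ∈ S, ∀ i ∈ S, β j i = 0 := by
  classical
  by_contra hcon
  push Not at hcon
  let h : {i : Fin n // m ≤ (i : ℕ)} → MvPolynomial (Fin n) k := fun j =>
    if j ∈ S then X (j : Fin n) else critBinomial k a j (β j)
  have hX : ∀ i ∈ S, X (i : Fin n) ∈ Ideal.span (Set.range h) := fun i hi =>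
    Ideal.subset_span ⟨i, by simp [h, hi]⟩
  have hle : toricIdeal k a ≤ Ideal.span (Set.range h) := by
    rw [hI, Ideal.span_le]
    rintro _ ⟨j, rfl⟩
    by_cases hj : j ∈ S
    · obtain ⟨i, hi, hne⟩ := hcon j hj
      refine Ideal.sub_mem _ ?_ ?_
      · rw [xpow_single]
        exact Ideal.pow_mem_of_mem _ (hX j hj) _ (Nat.pos_of_ne_zero (ha.critExp_ne_zero j.2))
      · rw [xpow, ← Finset.mul_prod_erase _ _ (Finset.mem_univ (i : Fin n))]
        exact Ideal.mul_mem_right _ _ (Ideal.pow_mem_of_mem _ (hX i hi) _ (Nat.pos_of_ne_zero hne))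
    · exact Ideal.subset_span ⟨j, by simp [h, hj, critBinomial]⟩
  have hcc : ∀ u : Fin n → ℕ, u ≠ 0 → constantCoeff (xpow k u) = 0 := by
    intro u hu
    rw [xpow_eq_monomial, constantCoeff_monomial, if_neg]
    intro h0
    exact hu (Finsupp.equivFunOnFinite.symm.injective (h0.trans (by ext; rfl)))
  have htop : Ideal.span (Set.range h) ≠ ⊤ := by
    refine ne_top_of_le_ne_top
      (RingHom.ker_ne_top (constantCoeff : MvPolynomial (Fin n) k →+* k)) ?_
    rw [Ideal.span_le]
    rintro _ ⟨j, rfl⟩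
    rw [SetLike.mem_coe, RingHom.mem_ker]
    by_cases hj : j ∈ S
    · simp [h, hj]
    · have hmj := ha.critExp_ne_zero j.2
      simp only [h, hj, if_false, critBinomial, map_sub]
      rw [hcc, hcc, sub_zero]
      · intro h0
        have h1 := hβ j j.2
        rw [h0, map_zero, eq_comm, ← wt_single] at h1
        exact hmj (by simpa using congrFun (wt_eq_zero ha.ne_zero h1) j)
      · intro h0
        exact hmj (by simpa using congrFun h0 j)
  obtain ⟨P, hP⟩ := Ideal.nonempty_minimalPrimes htop
  have hPprime : P.IsPrime := hP.1.1
  have hPheight : P.height ≤ ((n - m : ℕ) : ℕ∞) := by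
    refine (Ideal.height_le_card_of_mem_minimalPrimes_span (Set.finite_range h) hP).trans ?_
    rw [← card_nonaxis ha.lt.le, ← Nat.card_eq_fintype_card, ← Set.ncard_univ, ← Set.image_univ]
    exact_mod_cast Set.ncard_image_le Set.finite_univ
  have hIprime := toricIdeal_isPrime (k := k) a
  obtain ⟨j, hj⟩ := hS
  have hlt : toricIdeal k a < P := by
    refine lt_of_le_of_ne (hle.trans hP.1.2) ?_
    intro heq
    have h1 : X (j : Fin n) ∈ toricIdeal k a := heq ▸ hP.1.2 (hX j hj)
    rw [mem_toricIdeal, toricHom, aeval_X, xpow_eq_monomial, monomial_eq_zero] at h1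
    exact one_ne_zero h1
  have h2 := (Ideal.height_add_one_le_of_lt_of_isPrime hlt).trans hPheight
  rw [height_toricIdeal ha] at h2
  norm_cast at h2
  omega

/-- If the critical binomials generate the toric ideal, the only stable state is the empty one:
the lattice of relations has a basis that is triangular on the indices `≥ m`, so the first
remaining multiplier would be a multiple of its critical exponent. -/
theorem IsSimplicial.stable_eq_zero {a : Fin n → Fin m → ℕ} (ha : IsSimplicial a)
    {β : Fin n → Fin n → ℕ} (hβ : ∀ i : Fin n, m ≤ (i : ℕ) → wt a (β i) = critExp a i • a i)
    (hI : toricIdeal k a = Ideal.span (Set.range fun i : {i : Fin n // m ≤ (i : ℕ)} =>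
      xpow k (Pi.single (i : Fin n) (critExp a i)) - xpow k (β i)))
    {r : Fin n → ℕ} (hr : Stable a r) : r = 0 := by
  classical
  let prec : {i : Fin n // m ≤ (i : ℕ)} → {i : Fin n // m ≤ (i : ℕ)} → Prop :=
    fun j i => β j i ≠ 0
  have hwf' : WellFounded (Function.swap prec) := by
    rw [WellFounded.wellFounded_iff_has_min]
    intro S hS
    obtain ⟨j, hj, h⟩ := ha.exists_critical_avoiding hβ hI hS
    exact ⟨j, hj, fun i hi hne => hne (h i hi)⟩
  have hwf : WellFounded (Relation.TransGen prec) := by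
    have : Std.Irrefl (Relation.TransGen prec) := by
      refine ⟨fun i hi => ?_⟩
      rw [← Relation.transGen_swap] at hi
      exact (hwf'.transGen).irrefl.irrefl i hi
    exact Finite.wellFounded_of_trans_of_irrefl _
  have hlat : ∀ u ∈ relations a r, ∃ c : {i : Fin n // m ≤ (i : ℕ)} → ℤ,
      ∀ i : {i : Fin n // m ≤ (i : ℕ)}, u i = c i * critExp a i - ∑ j, c j * β j i := by
    intro u hu
    have h1 : wt a (fun j => (u j).toNat) = wt a (fun j => (-u j).toNat) := by
      rw [wt_eq_wt_iff, ← sub_eq_zero, ← map_sub, ← hu.1]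
      congr 1
      ext j
      simp only [Pi.sub_apply]
      omega
    rw [← sub_mem_toricIdeal_iff (k := k), hI] at h1
    have h2 := sub_mem_of_xpow_sub_mem (K := AddSubgroup.closure (Set.range
      fun (i : {i : Fin n // m ≤ (i : ℕ)}) (j : Fin n) =>
        ((Pi.single (i : Fin n) (critExp a i) : Fin n → ℕ) j : ℤ) - β i j))
      (fun i => AddSubgroup.subset_closure ⟨i, rfl⟩) h1
    rw [AddSubgroup.mem_closure_range_iff_of_fintype] at h2
    obtain ⟨c, hc⟩ := h2
    refine ⟨c, fun i => ?_⟩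
    have h3 := congrFun hc i
    rw [show (((u i).toNat : ℤ) - ((-u i).toNat : ℤ)) = u i by omega] at h3
    rw [h3]
    simp only [Finset.sum_apply, Pi.smul_apply, smul_eq_mul, mul_sub, Finset.sum_sub_distrib]
    congr 1
    rw [Finset.sum_eq_single i]
    · simp
    · intro j _ hj
      rw [Pi.single_eq_of_ne (fun h => hj (Subtype.ext h).symm)]
      simp
    · simp
  have hnon : ∀ i : {i : Fin n // m ≤ (i : ℕ)}, r i = 0 := by
    by_contra hne
    push Not at hne
    let D : Set {i : Fin n // m ≤ (i : ℕ)} := {i | r i ≠ 0}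
    have hD : D.Nonempty := hne
    set i := hwf.min D hD with hi
    have hiD : r i ≠ 0 := hwf.min_mem D hD
    have hmin : ∀ j, Relation.TransGen prec j i → r j = 0 := by
      intro j hj
      by_contra hrj
      exact hwf.not_lt_min D hrj hj
    obtain ⟨hnd, hdep⟩ := hr i hiD
    obtain ⟨u, hu, hui⟩ := (dep_iff_exists_relation dvd_rfl).1 hdep
    obtain ⟨c, hc⟩ := hlat u hu
    have hc0 : ∀ j, Relation.TransGen prec j i → c j = 0 := by
      intro j
      induction j using hwf.induction with
      | _ j ih =>
      intro hj
      have hsum : ∑ p, c p * β p j = 0 := by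
        refine Finset.sum_eq_zero fun p _ => ?_
        by_cases hp : β p j = 0
        · simp [hp]
        · rw [ih p (Relation.TransGen.single hp) (Relation.TransGen.head hp hj), zero_mul]
      have huj : u j = 0 := by
        have := hu.2 j
        rwa [hmin j hj, Nat.cast_zero, zero_dvd_iff] at this
      have h1 := hc j
      rw [hsum, huj, sub_zero, eq_comm, mul_eq_zero] at h1
      exact h1.resolve_right (by exact_mod_cast ha.critExp_ne_zero j.2)
    have hsum : ∑ p, c p * β p i = 0 := by
      refine Finset.sum_eq_zero fun p _ => ?_
      by_cases hp : β p i = 0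
      · simp [hp]
      · rw [hc0 p (Relation.TransGen.single hp), zero_mul]
    have h1 := hc i
    rw [hsum, hui, sub_zero] at h1
    refine hnd (Int.natCast_dvd_natCast.1 ⟨c i, ?_⟩)
    rw [h1, mul_comm]
  -- the axis vectors alone are independent
  ext i
  by_contra hri
  obtain ⟨hnd, γ, h1, h2, h3⟩ := hr i hri
  have him : (i : ℕ) < m := by
    by_contra hlt
    exact hri (hnon ⟨i, not_lt.1 hlt⟩)
  obtain ⟨d, hd, hax⟩ := ha.axis
  have haxis : ∀ (j : Fin n) (hj : (j : ℕ) < m), a j = Pi.single ⟨j, hj⟩ (d ⟨j, hj⟩) :=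
    fun j hj => hax ⟨j, hj⟩
  have h4 := congrFun h3 ⟨i, him⟩
  rw [zwt_def, Finset.sum_apply, Finset.sum_eq_zero] at h4
  · rw [Pi.smul_apply, haxis i him, Pi.single_eq_same, smul_eq_mul, eq_comm, mul_eq_zero] at h4
    rcases h4 with h4 | h4
    · exact hri (by exact_mod_cast h4)
    · exact (hd ⟨i, him⟩).ne' (by exact_mod_cast h4)
  · intro j _
    by_cases hj : (j : ℕ) < m
    · by_cases hji : j = i
      · simp [hji, h1]
      · rw [Pi.smul_apply, haxis j hj, Pi.single_eq_of_ne]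
        · simp
        · intro h
          exact hji (Fin.ext (congrArg Fin.val h).symm)
    · have h5 := h2 j
      rw [hnon ⟨j, not_lt.1 hj⟩, Nat.cast_zero, zero_dvd_iff] at h5
      simp [h5]

theorem IsSimplicial.exists_criticalBinomials {a : Fin n → Fin m → ℕ} (ha : IsSimplicial a) :
    ∃ β : Fin n → Fin n → ℕ, ∀ i : Fin n, m ≤ (i : ℕ) →
      β i i = 0 ∧ wt a (β i) = critExp a i • a i := by
  have hex : ∀ i : Fin n, ∃ β : Fin n → ℕ, m ≤ (i : ℕ) →
      β i = 0 ∧ wt a β = critExp a i • a i := by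
    intro i
    by_cases hi : m ≤ (i : ℕ)
    · obtain ⟨β, hβ⟩ := exists_wt_eq_critExp (ha.critExp_ne_zero hi)
      exact ⟨β, fun _ => hβ⟩
    · exact ⟨0, fun h => absurd h hi⟩
  choose β hβ using hex
  exact ⟨β, hβ⟩

theorem IsSimplicial.isCompleteIntersection_of_eq_span {a : Fin n → Fin m → ℕ}
    (ha : IsSimplicial a) {f : Fin n → MvPolynomial (Fin n) k}
    (h : toricIdeal k a = Ideal.span (f '' {i : Fin n | m ≤ (i : ℕ)})) :
    IsCompleteIntersection (toricIdeal k a) := by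
  refine le_antisymm ?_ (Ideal.height_le_spanFinrank _ (toricIdeal_isPrime a).ne_top)
  rw [height_toricIdeal ha, ← card_nonaxis ha.lt.le, ← Nat.card_eq_fintype_card]
  have h1 := Submodule.spanFinrank_span_le_ncard_of_finite
    (R := MvPolynomial (Fin n) k) (Set.toFinite (f '' {i : Fin n | m ≤ (i : ℕ)}))
  rw [← Ideal.span, ← h] at h1
  exact_mod_cast h1.trans (Set.ncard_image_le (Set.toFinite _))

end SimplicialToric

theorem proposition3p2 {k : Type*} [Field k] {n m : ℕ} (a : Fin n → Fin m → ℕ)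
    (ha : SimplicialToric.IsSimplicial a)
    (hne : ∀ i j : Fin n, i ≠ j → SimplicialToric.InConeOfOthers a i →
      SimplicialToric.InConeOfOthers a j →
      SimplicialToric.critExp a i • a i ≠ SimplicialToric.critExp a j • a j) :
    ∃ Ared : Finset (Fin m → ℕ),
      (∀ R : Finset (Fin m → ℕ),
        SimplicialToric.IsReduction (Finset.univ.image a) R ↔ R = Ared) ∧
      [SimplicialToric.IsCompleteIntersection (SimplicialToric.toricIdeal k a),
        ∀ f : Fin n → MvPolynomial (Fin n) k,
          (∀ i : Fin n, m ≤ (i : ℕ) → SimplicialToric.IsCriticalBinomial k a i (f i)) →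
            SimplicialToric.toricIdeal k a = Ideal.span (f '' {i : Fin n | m ≤ (i : ℕ)}),
        Ared = ∅].TFAE := by
  have H : SimplicialToric.CritDistinct a := fun i j hij hi hj =>
    hne i j hij (SimplicialToric.inConeOfOthers_of_critExp_ne_zero hi)
      (SimplicialToric.inConeOfOthers_of_critExp_ne_zero hj)
  obtain ⟨r, hreach, hstable, hout⟩ := SimplicialToric.exists_output ha.ne_zero ha.injective H
  obtain ⟨β, hβ⟩ := ha.exists_criticalBinomials
  have hcrit : ∀ i : Fin n, m ≤ (i : ℕ) → SimplicialToric.IsCriticalBinomial k a i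
      (SimplicialToric.critBinomial k a i (β i)) := fun i hi =>
    SimplicialToric.isCriticalBinomial_critBinomial (ha.critExp_ne_zero hi) (hβ i hi).1
      (hβ i hi).2
  refine ⟨_, hout, ?_⟩
  tfae_have 1 → 2 := fun h f hf => ha.toricIdeal_eq_of_isCompleteIntersection H h hf
  tfae_have 2 → 1 := fun h => ha.isCompleteIntersection_of_eq_span (h _ hcrit)
  tfae_have 2 → 3 := by
    intro h
    have h1 := h _ hcrit
    rw [SimplicialToric.critBinomial_image_eq fun i _ => rfl] at h1
    exact SimplicialToric.config_eq_empty.2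
      (ha.stable_eq_zero (fun i hi => (hβ i hi).2) h1 hstable)
  tfae_have 3 → 2 := by
    intro h f hf
    rw [SimplicialToric.config_eq_empty.1 h] at hreach
    refine le_antisymm (ha.toricIdeal_le_of_reach H hreach fun i hi =>
      ⟨f i, Ideal.subset_span ⟨i, hi, rfl⟩, hf i hi⟩) ?_
    rw [Ideal.span_le]
    rintro _ ⟨i, hi, rfl⟩
    exact (hf i hi).2.2
  tfae_finish
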